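/- Let $b:\mathbb{R}^d\to\mathbb{R}^d$ be contractive at infinity, i.e. there are constants $L,K,\mathcal{R}>0$ such that $$|b(x)-b(y)|\le L|x-y|\quad\text{for all }x,y\in\mathbb{R}^d,\qquad \langle x-y,\,b(x)-b(y)\rangle\le -K|x-y|^2\quad\text{whenever }|x-y|>\mathcal{R}.$$ Let $\pi$ be the invariant probability measure of the stochastic differential equation $dY_t=b(Y_t)\,dt+dW_t$, where $W$ is a standard $d$-dimensional Brownian motion, let $\mu_0$ be a probability measure on $\mathbb{R}^d$ with finite second moment, and let $\sigma,\alpha>0$. For $p\in\{1,2\}$ let $$W_p(\mu,\nu)=\Big(\inf_{\gamma}\int_{\mathbb{R}^d\times\mathbb{R}^d}|x-y|^p\,\gamma(dx\,dy)\Big)^{1/p}\in[0,\infty],$$ the infimum being over all couplings $\gamma$ of $\mu$ and $\nu$. For a step size $h>0$ consider the Euler scheme $$X_{k+1}=X_k+h\,b(X_k)+\sqrt{h}\,\xi_{k+1},\qquad X_0\sim\mu_0,$$ where $(\xi_k)_{k\ge1}$ are i.i.d. with law $N(0,I)$ and independent of $X_0$, and the Euler scheme with randomised drift $$\bar X_{k+1}=\bar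 X_k+h\,\bar b(\bar X_k,U_k)+\sqrt{h}\,\xi_{k+1},\qquad \bar X_0\sim\mu_0,$$ where $(\xi_k)_{k\ge1}$ are again i.i.d. with law $N(0,I)$, $(U_k)_{k\ge0}$ are i.i.d. copies of an $\mathbb{R}^n$-valued random variable $U$, and $\bar X_0$, $(U_k)_{k\ge0}$, $(\xi_k)_{k\ge1}$ are independent. Here the measurable drift estimator $\bar b:\mathbb{R}^d\times\mathbb{R}^n\to\mathbb{R}^d$, the dimension $n$ and the law of $U$ may depend on $h$. Then there exist constants $h_0,\bar C_1,\bar C_2>0$, which do not depend on $h$, $k$, $n$, $\bar b$ or the law of $U$, such that for all $h\in(0,h_0)$, all $n\ge 0$, and all $\bar b$ and $U$ satisfying $$\mathbb{E}[\bar b(x,U)]=b(x)\quad\text{and}\quad \mathbb{E}\,|\bar b(x,U)-b(x)|^2\le\sigma^2(1+|x|^2)h^{\alpha}\qquad\text{for all }x\in\mathbb{R}^d,$$ we have for all $k\ge0$ $$W_2(\mathcal{L}(\bar X_k),\pi)\le W_2(\mathcal{L}(X_k),\pi)+\bar C_2h^{\alpha/4}$$ and $$W_1(\mathcal{L}(\bar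 X_k),\pi)\le W_1(\mathcal{L}(X_k),\pi)+\bar C_1h^{\alpha/2}.$$ -/

import Mathlib

open MeasureTheory ProbabilityTheory
open scoped ENNReal NNReal

/-- `ℝ^d` with the Euclidean norm, inner product and Borel `σ`-algebra. -/
abbrev Eucl (d : ℕ) : Type := EuclideanSpace ℝ (Fin d)

/-- The couplings `Π(μ, ν)`: measures on the product space with marginals `μ` and `ν`. -/
def couplings {d : ℕ} (μ ν : Measure (Eucl d)) : Set (Measure (Eucl d × Eucl d)) :=
  {γ | γ.map Prod.fst = μ ∧ γ.map Prod.snd = ν}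

/-- The `L^p`-Wasserstein distance `(inf_{γ ∈ Π(μ,ν)} ∫ |x - y|^p γ(dx dy))^{1/p}`, with values in
`[0, ∞]`, so that it makes sense without any moment assumption. -/
noncomputable def wasserstein {d : ℕ} (p : ℝ) (μ ν : Measure (Eucl d)) : ℝ≥0∞ :=
  (⨅ γ ∈ couplings μ ν, ∫⁻ z, edist z.1 z.2 ^ p ∂γ) ^ (1 / p)

/-- Contractivity at infinity of the drift `b`, with constants `L`, `K`, `R`. -/
structure ContractiveAtInfinity {d : ℕ} (b : Eucl d → Eucl d) (L K R : ℝ) : Prop where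
  L_pos : 0 < L
  K_pos : 0 < K
  R_pos : 0 < R
  lipschitz : ∀ x y, ‖b x - b y‖ ≤ L * ‖x - y‖
  contractive : ∀ x y, R < ‖x - y‖ → inner ℝ (x - y) (b x - b y) ≤ -K * ‖x - y‖ ^ 2

/-- `bbar(·, U)` with `U ∼ ν` is an estimator of the drift `b` that is unbiased,
`E[bbar(x, U)] = b(x)`, and satisfies the variance bound
`E|bbar(x, U) - b(x)|² ≤ σ² (1 + |x|²) h^α` at the step size `h`. -/
structure IsDriftEstimator {d n : ℕ} (b : Eucl d → Eucl d) (bbar : Eucl d → Eucl n → Eucl d)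
    (ν : Measure (Eucl n)) (σ α h : ℝ) : Prop where
  measurable : Measurable (Function.uncurry bbar)
  integrable : ∀ x, Integrable (bbar x) ν
  unbiased : ∀ x, ∫ u, bbar x u ∂ν = b x
  variance_le : ∀ x, ∫⁻ u, ‖bbar x u - b x‖ₑ ^ 2 ∂ν ≤
    ENNReal.ofReal (σ ^ 2 * (1 + ‖x‖ ^ 2) * h ^ α)

section Schemes

variable {Ω : Type*} [MeasurableSpace Ω] {d n : ℕ}

/-- `X` is the Euler scheme `X_{k+1} = X_k + h b(X_k) + √h ξ_{k+1}`, `X_0 ∼ μ₀`, with i.i.d.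
standard normal `ξ_1, ξ_2, …` independent of `X_0`. The variable `ξ_{k+1}` is written `ξ k`. -/
structure IsEulerScheme (b : Eucl d → Eucl d) (h : ℝ) (μ₀ : Measure (Eucl d)) (P : Measure Ω)
    (ξ : ℕ → Ω → Eucl d) (X : ℕ → Ω → Eucl d) : Prop where
  law_zero : HasLaw (X 0) μ₀ P
  law_noise : ∀ k, HasLaw (ξ k) (stdGaussian (Eucl d)) P
  indep_noise : iIndepFun ξ P
  indep_zero : IndepFun (X 0) (fun ω k => ξ k ω) P
  step : ∀ k, ∀ᵐ ω ∂P, X (k + 1) ω = X k ω + h • b (X k ω) + √h • ξ k ω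

/-- `X` is the Euler scheme with randomised drift
`X_{k+1} = X_k + h bbar(X_k, U_k) + √h ξ_{k+1}`, `X_0 ∼ μ₀`, with i.i.d. standard normal
`ξ_1, ξ_2, …` and i.i.d. `U_0, U_1, …` of law `ν`, such that `X_0`, `(U_k)_k` and `(ξ_k)_k` are
independent. The variable `ξ_{k+1}` is written `ξ k`. -/
structure IsRandomisedEulerScheme (bbar : Eucl d → Eucl n → Eucl d) (ν : Measure (Eucl n))
    (h : ℝ) (μ₀ : Measure (Eucl d)) (P : Measure Ω)
    (ξ : ℕ → Ω → Eucl d) (U : ℕ → Ω → Eucl n) (X : ℕ → Ω → Eucl d) : Prop where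
  law_zero : HasLaw (X 0) μ₀ P
  law_noise : ∀ k, HasLaw (ξ k) (stdGaussian (Eucl d)) P
  law_U : ∀ k, HasLaw (U k) ν P
  indep_noise : iIndepFun ξ P
  indep_U : iIndepFun U P
  indep_U_noise : IndepFun (fun ω k => U k ω) (fun ω k => ξ k ω) P
  indep_zero : IndepFun (X 0) (fun ω => ((fun k => U k ω), (fun k => ξ k ω))) P
  step : ∀ k, ∀ᵐ ω ∂P, X (k + 1) ω = X k ω + h • bbar (X k ω) (U k ω) + √h • ξ k ω

/-- A standard `d`-dimensional Brownian motion: the coordinates are independent standard real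
Brownian motions. -/
structure IsBrownianMotion (W : ℝ≥0 → Ω → Eucl d) (P : Measure Ω) : Prop where
  coord : ∀ i, IsBrownianReal (fun t ω => W t ω i) P
  indep : iIndepFun (fun (i : Fin d) ω (t : ℝ≥0) => W t ω i) P

/-- `Y` solves `dY_t = b(Y_t) dt + dW_t`, where `W` is a Brownian motion independent of `Y_0`.
Since the noise is additive, the integrated equation holds pathwise. -/
structure IsSDESolution (b : Eucl d → Eucl d) (P : Measure Ω)
    (W : ℝ≥0 → Ω → Eucl d) (Y : ℝ≥0 → Ω → Eucl d) : Prop where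
  brownian : IsBrownianMotion W P
  aemeasurable : ∀ t, AEMeasurable (Y t) P
  indep_zero : IndepFun (Y 0) (fun ω t => W t ω) P
  continuous : ∀ᵐ ω ∂P, Continuous fun t => Y t ω
  eq_integral : ∀ᵐ ω ∂P, ∀ t : ℝ≥0,
    Y t ω = Y 0 ω + (∫ s in (0 : ℝ)..t, b (Y s.toNNReal ω)) + W t ω

end Schemes

/-- `π` is an invariant probability measure of `dY_t = b(Y_t) dt + dW_t`: the solution started
from `Y_0 ∼ π` has law `π` at all times. -/
def IsInvariantMeasure {d : ℕ} (b : Eucl d → Eucl d) (π : Measure (Eucl d)) : Prop :=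
  IsProbabilityMeasure π ∧
  ∃ (Ω : Type) (_ : MeasurableSpace Ω) (P : Measure Ω) (W Y : ℝ≥0 → Ω → Eucl d),
    IsProbabilityMeasure P ∧ IsSDESolution b P W Y ∧ ∀ t, P.map (Y t) = π

/-!
The two Euler schemes are compared with each other, uniformly in time, and the comparison is carried
over to `π` by the triangle inequality for the Wasserstein distance (`wasserstein_le_add`, which
rests on the gluing of couplings).

The comparison uses the cost `f(|x - y|)`, `f(r) = 1 - e^{-ar} + ε r²`, which dominates multiples
of both `|x - y|` and `|x - y|²`; therefore a coupling of cost `O(h^{α/2})` yields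
`W₁ = O(h^{α/2})` and `W₂ = O(h^{α/4})`. Such a coupling is built step by step
(`exists_coupling_eulerLaw`): one step of the scheme with the exact drift contracts the cost by a
factor `1 - ch`, while exchanging the drift for its estimator adds at most `O(h · h^{α/2})`, by
the variance bound and the uniform second moments (`exists_moment_bound`). Summing the geometric
series gives the claim.

The contraction needs the noise, because `b` contracts only large distances. The Gaussian increments
are coupled by the maximal reflection coupling: the two points are merged with the largest possible
probability, and otherwise the noise is reflected in the hyperplane that separates them
(`lintegral_coupledNoise_eq`). By the reflection principle the expected cost after a Gaussian step
that starts at distance `ρ` is `E f̃(ρ + 2√h ζ)`, where `f̃` is the odd extension of `f` and `ζ` is a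
standard normal variable (`lintegral_coupledNoise_le`). The concavity of `1 - e^{-ar}` makes this
smaller than `f(ρ)` by a multiple of `√h min(ρ, √h)` (`reflectedCost_le`), which for large `a`
and small `ε` beats the expansion of small distances by the Lipschitz drift. Large distances are
contracted by the drift itself, which the quadratic part of `f` detects
(`exists_reflectedCost_contraction`).
-/

/-! ### The odd concave cost and its Gaussian average -/

/-- The odd extension to `ℝ` of the concave function `r ↦ 1 - e^{-ar}` on `[0, ∞)`. -/
noncomputable def oddExp (a x : ℝ) : ℝ :=
  if 0 ≤ x then 1 - Real.exp (-(a * x)) else Real.exp (a * x) - 1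

/-- The odd extension to `ℝ` of the cost `r ↦ 1 - e^{-ar} + ε r²` on `[0, ∞)`. -/
noncomputable def oddCost (a ε x : ℝ) : ℝ := oddExp a x + ε * (x * |x|)

/-- The mean of the odd cost at `ρ + s ζ` with `ζ` standard normal. By the reflection principle
this is the expected cost after a maximal reflection coupling, see `lintegral_coupledNoise_le`. -/
noncomputable def reflectedCost (a ε s ρ : ℝ) : ℝ := ∫ t, oddCost a ε (ρ + s * t) ∂gaussianReal 0 1

lemma exp_neg_le_one_sub_half {x : ℝ} (h0 : 0 ≤ x) (h1 : x ≤ 1) :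
    Real.exp (-x) ≤ 1 - x / 2 := by
  have h2 : 0 < 1 + x := by linarith
  rw [Real.exp_neg]
  calc (Real.exp x)⁻¹ ≤ (1 + x)⁻¹ := inv_anti₀ h2 (by linarith [Real.add_one_le_exp x])
    _ ≤ 1 - x / 2 := by
      rw [inv_le_iff_one_le_mul₀ h2]
      nlinarith

section OddExp

variable {a : ℝ}

lemma oddExp_of_nonneg {x : ℝ} (hx : 0 ≤ x) : oddExp a x = 1 - Real.exp (-(a * x)) := if_pos hx

lemma oddExp_of_nonpos {x : ℝ} (hx : x ≤ 0) : oddExp a x = Real.exp (a * x) - 1 := by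
  rcases hx.eq_or_lt with rfl | hx
  · simp [oddExp]
  · exact if_neg (not_le.mpr hx)

lemma oddExp_neg (x : ℝ) : oddExp a (-x) = -oddExp a x := by
  rcases le_total 0 x with hx | hx
  · rw [oddExp_of_nonneg hx, oddExp_of_nonpos (by linarith)]; ring_nf
  · rw [oddExp_of_nonpos hx, oddExp_of_nonneg (by linarith)]; ring_nf

lemma measurable_oddExp : Measurable (oddExp a) :=
  Measurable.ite measurableSet_Ici (by fun_prop) (by fun_prop)

lemma abs_oddExp_le (ha : 0 ≤ a) (x : ℝ) : |oddExp a x| ≤ 1 := by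
  rcases le_total 0 x with hx | hx
  · rw [oddExp_of_nonneg hx, abs_le]
    have h1 := Real.exp_pos (-(a * x))
    have h2 : Real.exp (-(a * x)) ≤ 1 := Real.exp_le_one_iff.mpr (by nlinarith)
    constructor <;> linarith
  · rw [oddExp_of_nonpos hx, abs_le]
    have h1 := Real.exp_pos (a * x)
    have h2 : Real.exp (a * x) ≤ 1 := Real.exp_le_one_iff.mpr (by nlinarith)
    constructor <;> linarith

lemma oddExp_mono (ha : 0 ≤ a) : Monotone (oddExp a) := by
  intro x y hxy
  rcases le_total 0 x with hx | hx
  · rw [oddExp_of_nonneg hx, oddExp_of_nonneg (hx.trans hxy)]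
    have : Real.exp (-(a * y)) ≤ Real.exp (-(a * x)) := Real.exp_le_exp.mpr (by nlinarith)
    linarith
  rcases le_total 0 y with hy | hy
  · rw [oddExp_of_nonpos hx, oddExp_of_nonneg hy]
    have h1 : Real.exp (-(a * y)) ≤ 1 := Real.exp_le_one_iff.mpr (by nlinarith)
    have h2 : Real.exp (a * x) ≤ 1 := Real.exp_le_one_iff.mpr (by nlinarith)
    linarith
  · rw [oddExp_of_nonpos hx, oddExp_of_nonpos hy]
    have : Real.exp (a * x) ≤ Real.exp (a * y) := Real.exp_le_exp.mpr (by nlinarith)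
    linarith

lemma oddExp_sub_le_of_nonneg {x δ : ℝ} (hx : 0 ≤ x) (hδ : 0 ≤ δ) :
    oddExp a (x + δ) - oddExp a x ≤ a * Real.exp (-(a * x)) * δ := by
  rw [oddExp_of_nonneg hx, oddExp_of_nonneg (add_nonneg hx hδ)]
  have h1 : Real.exp (-(a * (x + δ))) = Real.exp (-(a * x)) * Real.exp (-(a * δ)) := by
    rw [← Real.exp_add]; ring_nf
  have h2 := Real.add_one_le_exp (-(a * δ))
  rw [h1]
  nlinarith [Real.exp_pos (-(a * x))]

lemma oddExp_sub_le (ha : 0 ≤ a) {x δ : ℝ} (hδ : 0 ≤ δ) :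
    oddExp a (x + δ) - oddExp a x ≤ a * δ := by
  have key : ∀ y η : ℝ, 0 ≤ y → 0 ≤ η → oddExp a (y + η) - oddExp a y ≤ a * η := by
    intro y η hy hη
    refine (oddExp_sub_le_of_nonneg hy hη).trans ?_
    have h2 : Real.exp (-(a * y)) ≤ 1 := Real.exp_le_one_iff.mpr (by nlinarith)
    nlinarith [mul_nonneg ha hη]
  have h0 : oddExp a 0 = 0 := by simp [oddExp]
  rcases le_total 0 x with hx | hx
  · exact key x δ hx hδ
  rcases le_total 0 (x + δ) with hy | hy
  · have h1 := key 0 (x + δ) le_rfl hy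
    have h2 := key 0 (-x) le_rfl (by linarith)
    rw [zero_add, oddExp_neg] at h2
    rw [zero_add] at h1
    linarith
  · have h1 := key (-(x + δ)) δ (by linarith) hδ
    rw [show -(x + δ) + δ = -x by ring, oddExp_neg, oddExp_neg] at h1
    linarith

/-- The symmetric second difference of `oddExp` at `ρ ≥ 0` with a step `u ≥ 0` beyond `ρ`. -/
lemma oddExp_add_sub_of_le (ρ u : ℝ) (hρ : 0 ≤ ρ) (hu : ρ ≤ u) :
    oddExp a (ρ + u) + oddExp a (ρ - u) - 2 * oddExp a ρ =
      -(Real.exp (-(a * ρ)) * ((Real.exp (a * ρ) - 1) *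
        (2 - Real.exp (-(a * u)) * (Real.exp (a * ρ) + 1)))) := by
  rw [oddExp_of_nonneg (by linarith), oddExp_of_nonpos (by linarith), oddExp_of_nonneg hρ]
  have h1 : Real.exp (-(a * (ρ + u))) = Real.exp (-(a * ρ)) * Real.exp (-(a * u)) := by
    rw [← Real.exp_add]; ring_nf
  have h2 : Real.exp (a * (ρ - u)) = Real.exp (a * ρ) * Real.exp (-(a * u)) := by
    rw [← Real.exp_add]; ring_nf
  have h3 : Real.exp (a * ρ) = (Real.exp (-(a * ρ)))⁻¹ := by rw [← Real.exp_neg]; ring_nf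
  have h4 := (Real.exp_pos (-(a * ρ))).ne'
  rw [h1, h2, h3]
  field_simp
  ring

/-- The symmetric second difference of `oddExp` at `ρ ≥ 0` with a step `0 ≤ u ≤ ρ`. -/
lemma oddExp_add_sub_of_ge (ρ u : ℝ) (hu0 : 0 ≤ u) (hu : u ≤ ρ) :
    oddExp a (ρ + u) + oddExp a (ρ - u) - 2 * oddExp a ρ =
      -(Real.exp (-(a * ρ)) * (2 * (Real.cosh (a * u) - 1))) := by
  rw [oddExp_of_nonneg (by linarith), oddExp_of_nonneg (by linarith),
    oddExp_of_nonneg (by linarith)]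
  have h1 : Real.exp (-(a * (ρ + u))) = Real.exp (-(a * ρ)) * Real.exp (-(a * u)) := by
    rw [← Real.exp_add]; ring_nf
  have h2 : Real.exp (-(a * (ρ - u))) = Real.exp (-(a * ρ)) * Real.exp (a * u) := by
    rw [← Real.exp_add]; ring_nf
  rw [h1, h2, Real.cosh_eq]
  ring

/-- Because of its symmetry, it is enough to treat nonnegative steps of a second difference. -/
lemma add_sub_abs (F : ℝ → ℝ) (ρ u : ℝ) : F (ρ + u) + F (ρ - u) = F (ρ + |u|) + F (ρ - |u|) := by
  rcases abs_choice u with h | h <;> rw [h]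
  rw [sub_neg_eq_add, ← sub_eq_add_neg, add_comm]

lemma oddExp_add_sub_nonpos (ha : 0 ≤ a) {ρ : ℝ} (hρ : 0 ≤ ρ) (u : ℝ) :
    oddExp a (ρ + u) + oddExp a (ρ - u) - 2 * oddExp a ρ ≤ 0 := by
  rw [add_sub_abs]
  have hu := abs_nonneg u
  set v := |u|
  rcases le_total ρ v with h | h
  · rw [oddExp_add_sub_of_le ρ v hρ h, neg_nonpos]
    have h1 : 1 ≤ Real.exp (a * ρ) := Real.one_le_exp (by positivity)
    have h2 : Real.exp (-(a * v)) * Real.exp (a * ρ) ≤ 1 := by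
      rw [← Real.exp_add]; exact Real.exp_le_one_iff.mpr (by nlinarith)
    have h3 : Real.exp (-(a * v)) ≤ 1 := Real.exp_le_one_iff.mpr (by nlinarith)
    exact mul_nonneg (Real.exp_pos _).le (mul_nonneg (by linarith) (by linarith))
  · rw [oddExp_add_sub_of_ge ρ v hu h, neg_nonpos]
    have := Real.one_le_cosh (a * v)
    exact mul_nonneg (Real.exp_pos _).le (by linarith)

/-- A strict gain in the concavity of `oddExp` for all steps of size at least `s`. For `ρ < s` the
step leaves `[0, ∞)`, and the gain is only of order `ρ s`. -/
lemma oddExp_add_sub_le (ha : 0 < a) {ρ s u : ℝ} (hρ : 0 ≤ ρ) (hs : 0 ≤ s) (has : a * s ≤ 1)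
    (hu : s ≤ |u|) :
    oddExp a (ρ + u) + oddExp a (ρ - u) - 2 * oddExp a ρ ≤
      -(1 / 2 * (Real.exp (-(a * ρ)) * a ^ 2 * (s * min ρ s))) := by
  rw [add_sub_abs]
  have hu0 := abs_nonneg u
  set v := |u|
  rcases le_total ρ v with h | h
  · rw [oddExp_add_sub_of_le ρ v hρ h, neg_le_neg_iff]
    have h1 : a * ρ ≤ Real.exp (a * ρ) - 1 := by linarith [Real.add_one_le_exp (a * ρ)]
    have h2 : Real.exp (-(a * v)) * Real.exp (a * ρ) ≤ 1 := by
      rw [← Real.exp_add]; exact Real.exp_le_one_iff.mpr (by nlinarith)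
    have h3 : Real.exp (-(a * v)) ≤ Real.exp (-(a * s)) := Real.exp_le_exp.mpr (by nlinarith)
    have h4 := exp_neg_le_one_sub_half (mul_nonneg ha.le hs) has
    have h5 : a * s / 2 ≤ 2 - Real.exp (-(a * v)) * (Real.exp (a * ρ) + 1) := by linarith
    have h6 : a * ρ * (a * s / 2) ≤ (Real.exp (a * ρ) - 1) *
        (2 - Real.exp (-(a * v)) * (Real.exp (a * ρ) + 1)) :=
      mul_le_mul h1 h5 (by positivity) (le_trans (by positivity) h1)
    have h7 : s * min ρ s ≤ s * ρ := mul_le_mul_of_nonneg_left (min_le_left _ _) hs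
    calc 1 / 2 * (Real.exp (-(a * ρ)) * a ^ 2 * (s * min ρ s))
        ≤ 1 / 2 * (Real.exp (-(a * ρ)) * a ^ 2 * (s * ρ)) := by gcongr
      _ = Real.exp (-(a * ρ)) * (a * ρ * (a * s / 2)) := by ring
      _ ≤ _ := mul_le_mul_of_nonneg_left h6 (Real.exp_pos _).le
  · rw [oddExp_add_sub_of_ge ρ v hu0 h, neg_le_neg_iff]
    have h1 : 1 + (a * v) ^ 2 / 2 ≤ Real.cosh (a * v) := by
      have h2 := Real.cosh_two_mul (a * v / 2)
      have h3 := Real.cosh_sq (a * v / 2)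
      have h4 : a * v / 2 ≤ Real.sinh (a * v / 2) := Real.self_le_sinh_iff.mpr (by positivity)
      rw [mul_div_cancel₀ _ (two_ne_zero)] at h2
      nlinarith [mul_nonneg ha.le hu0]
    have h7 : s * min ρ s ≤ v * v :=
      mul_le_mul hu ((min_le_right _ _).trans hu) (le_min hρ hs) hu0
    calc 1 / 2 * (Real.exp (-(a * ρ)) * a ^ 2 * (s * min ρ s))
        ≤ 1 / 2 * (Real.exp (-(a * ρ)) * a ^ 2 * (v * v)) := by gcongr
      _ = Real.exp (-(a * ρ)) * ((a * v) ^ 2 / 2) := by ring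
      _ ≤ _ := mul_le_mul_of_nonneg_left (by nlinarith [sq_nonneg (a * v)]) (Real.exp_pos _).le

end OddExp

section SignedSquare

lemma mul_abs_mono : Monotone fun x : ℝ => x * |x| := by
  intro x y hxy
  simp only
  rcases abs_cases x with ⟨h1, h1'⟩ | ⟨h1, h1'⟩ <;>
    rcases abs_cases y with ⟨h2, h2'⟩ | ⟨h2, h2'⟩ <;>
    rw [h1, h2] <;> nlinarith

lemma mul_abs_sub_le {x δ : ℝ} (hδ : 0 ≤ δ) :
    (x + δ) * |x + δ| - x * |x| ≤ 2 * δ * (|x| + δ) := by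
  rcases abs_cases x with ⟨h1, h1'⟩ | ⟨h1, h1'⟩ <;>
    rcases abs_cases (x + δ) with ⟨h2, h2'⟩ | ⟨h2, h2'⟩ <;> rw [h1, h2] <;> nlinarith

lemma mul_abs_add_sub_le {ρ : ℝ} (hρ : 0 ≤ ρ) (u : ℝ) :
    (ρ + u) * |ρ + u| + (ρ - u) * |ρ - u| - 2 * (ρ * |ρ|) ≤ 2 * u ^ 2 ∧
    (ρ + u) * |ρ + u| + (ρ - u) * |ρ - u| - 2 * (ρ * |ρ|) ≤ 4 * ρ * |u| := by
  rw [add_sub_abs (fun x => x * |x|) ρ u, ← sq_abs u]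
  have hu := abs_nonneg u
  set v := |u|
  rw [abs_of_nonneg hρ, abs_of_nonneg (add_nonneg hρ hu)]
  rcases abs_cases (ρ - v) with ⟨h1, h1'⟩ | ⟨h1, h1'⟩ <;> rw [h1] <;> constructor <;>
    nlinarith [sq_nonneg (ρ - v)]

end SignedSquare

section ReflectedCost

variable {a ε : ℝ}

lemma oddCost_zero : oddCost a ε 0 = 0 := by simp [oddCost, oddExp]

lemma oddCost_neg (x : ℝ) : oddCost a ε (-x) = -oddCost a ε x := by
  rw [oddCost, oddCost, oddExp_neg, abs_neg]; ring

lemma measurable_oddCost : Measurable (oddCost a ε) := by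
  have := measurable_oddExp (a := a)
  unfold oddCost
  fun_prop

lemma oddCost_mono (ha : 0 ≤ a) (hε : 0 ≤ ε) : Monotone (oddCost a ε) := fun _ _ hxy =>
  add_le_add (oddExp_mono ha hxy) (mul_le_mul_of_nonneg_left (mul_abs_mono hxy) hε)

lemma oddCost_nonneg (ha : 0 ≤ a) (hε : 0 ≤ ε) {x : ℝ} (hx : 0 ≤ x) : 0 ≤ oddCost a ε x :=
  (oddCost_zero (a := a) (ε := ε)).symm.le.trans (oddCost_mono ha hε hx)

lemma oddCost_sub_le (ha : 0 ≤ a) (hε : 0 ≤ ε) {x δ : ℝ} (hδ : 0 ≤ δ) :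
    oddCost a ε (x + δ) ≤ oddCost a ε x + (a * δ + 2 * ε * δ * (|x| + δ)) := by
  have h1 := oddExp_sub_le ha (x := x) hδ
  have h2 := mul_le_mul_of_nonneg_left (mul_abs_sub_le (x := x) hδ) hε
  unfold oddCost
  linarith

lemma mul_sq_le_oddCost (ha : 0 ≤ a) {x : ℝ} (hx : 0 ≤ x) : ε * x ^ 2 ≤ oddCost a ε x := by
  have h := oddExp_mono ha hx
  rw [show oddExp a 0 = 0 by simp [oddExp]] at h
  rw [oddCost, abs_of_nonneg hx]
  linarith

/-- The cost dominates a multiple of the distance: the concave part does near `0`, and the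
quadratic part far away. -/
lemma exists_mul_le_oddCost (ha : 0 < a) (hε : 0 < ε) :
    ∃ κ > 0, ∀ x, 0 ≤ x → κ * x ≤ oddCost a ε x := by
  refine ⟨min (a / 2) (ε / a), by positivity, fun x hx => ?_⟩
  rcases le_total (a * x) 1 with h | h
  · have h7 := exp_neg_le_one_sub_half (mul_nonneg ha.le hx) h
    have h8 : min (a / 2) (ε / a) * x ≤ a / 2 * x :=
      mul_le_mul_of_nonneg_right (min_le_left _ _) hx
    rw [oddCost, oddExp_of_nonneg hx, abs_of_nonneg hx]
    nlinarith [mul_nonneg hε.le (mul_nonneg hx hx)]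
  · calc min (a / 2) (ε / a) * x ≤ ε / a * x := mul_le_mul_of_nonneg_right (min_le_right _ _) hx
      _ ≤ ε / a * x * (a * x) := le_mul_of_one_le_right (by positivity) h
      _ = ε * x ^ 2 := by field_simp
      _ ≤ _ := mul_sq_le_oddCost ha.le hx

lemma abs_oddCost_le (ha : 0 ≤ a) (hε : 0 ≤ ε) (x : ℝ) : |oddCost a ε x| ≤ 1 + ε * x ^ 2 := by
  refine (abs_add_le _ _).trans (add_le_add (abs_oddExp_le ha x) ?_)
  rw [abs_mul, abs_mul, abs_abs, abs_of_nonneg hε, ← sq, sq_abs]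

lemma memLp_affine_gaussianReal (s ρ : ℝ) :
    MemLp (fun t => ρ + s * t) 2 (gaussianReal 0 1) :=
  (memLp_const ρ).add ((memLp_id_gaussianReal 2).const_mul s)

lemma integrable_oddCost (ha : 0 ≤ a) (hε : 0 ≤ ε) (s ρ : ℝ) :
    Integrable (fun t => oddCost a ε (ρ + s * t)) (gaussianReal 0 1) := by
  have h := (memLp_affine_gaussianReal s ρ).integrable_sq
  refine Integrable.mono' ((integrable_const 1).add (h.const_mul ε))
    (measurable_oddCost.comp (by fun_prop)).aestronglyMeasurable ?_
  exact Filter.Eventually.of_forall fun t => abs_oddCost_le ha hε _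

lemma reflectedCost_mono (ha : 0 ≤ a) (hε : 0 ≤ ε) (s : ℝ) : Monotone (reflectedCost a ε s) :=
  fun x y hxy => integral_mono (integrable_oddCost ha hε s x) (integrable_oddCost ha hε s y)
    fun t => oddCost_mono ha hε (by linarith)

lemma integral_sq_gaussianReal : ∫ t, t ^ 2 ∂gaussianReal 0 1 = 1 := by
  have h := variance_fun_id_gaussianReal (μ := 0) (v := 1)
  rw [variance_of_integral_eq_zero (by fun_prop) (by simp)] at h
  simpa using h

lemma integrable_sq_gaussianReal : Integrable (fun t : ℝ => t ^ 2) (gaussianReal 0 1) :=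
  (memLp_id_gaussianReal 2).integrable_sq

lemma integrable_abs_gaussianReal : Integrable (fun t : ℝ => |t|) (gaussianReal 0 1) :=
  ((memLp_id_gaussianReal 1).integrable le_rfl).abs

lemma integral_abs_gaussianReal_le : ∫ t, |t| ∂gaussianReal 0 1 ≤ 1 := by
  calc ∫ t, |t| ∂gaussianReal 0 1 ≤ ∫ t, (1 + t ^ 2) / 2 ∂gaussianReal 0 1 := by
        refine integral_mono integrable_abs_gaussianReal
          (((integrable_const 1).add integrable_sq_gaussianReal).div_const 2) fun t => ?_
        nlinarith [sq_nonneg (|t| - 1), sq_abs t]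
    _ = 1 := by
      rw [integral_div, integral_add (integrable_const 1) integrable_sq_gaussianReal,
        integral_sq_gaussianReal]
      simp

/-- The averaged cost is, like the cost, locally Lipschitz with linearly growing constant. -/
lemma reflectedCost_add_le (ha : 0 ≤ a) (hε : 0 ≤ ε) {s ρ δ : ℝ} (hs : 0 ≤ s) (hρ : 0 ≤ ρ)
    (hδ : 0 ≤ δ) :
    reflectedCost a ε s (ρ + δ) ≤ reflectedCost a ε s ρ + (a * δ + 2 * ε * δ * (ρ + s + δ)) := by
  set A := a * δ + 2 * ε * δ * (ρ + δ) with hA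
  set B := 2 * ε * δ * s with hB
  have hi : Integrable (fun t : ℝ => B * |t|) (gaussianReal 0 1) :=
    integrable_abs_gaussianReal.const_mul B
  have hint : Integrable (fun t : ℝ => A + B * |t|) (gaussianReal 0 1) :=
    (integrable_const A).add hi
  calc reflectedCost a ε s (ρ + δ)
      ≤ ∫ t, (oddCost a ε (ρ + s * t) + (A + B * |t|)) ∂gaussianReal 0 1 := by
        refine integral_mono (integrable_oddCost ha hε s _)
          ((integrable_oddCost ha hε s ρ).add hint) fun t => ?_
        have h1 := oddCost_sub_le ha hε (x := ρ + s * t) hδ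
        have h2 : |ρ + s * t| ≤ ρ + s * |t| := by
          refine (abs_add_le _ _).trans ?_
          rw [abs_mul, abs_of_nonneg hρ, abs_of_nonneg hs]
        have h3 := mul_le_mul_of_nonneg_left h2 (by positivity : 0 ≤ 2 * ε * δ)
        simp only
        rw [show ρ + δ + s * t = ρ + s * t + δ by ring, hA, hB]
        linarith
    _ = reflectedCost a ε s ρ + (A + B * ∫ t, |t| ∂gaussianReal 0 1) := by
        rw [integral_add (integrable_oddCost ha hε s ρ) hint, reflectedCost,
          integral_add (integrable_const A) hi, integral_const_mul]
        simp
    _ ≤ _ := by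
        have h4 := mul_le_mul_of_nonneg_left integral_abs_gaussianReal_le
          (by positivity : 0 ≤ B)
        rw [hA]
        rw [hB] at h4 ⊢
        linarith

/-- The probability that a standard normal variable has absolute value at least `1`. -/
noncomputable def gaussianTail : ℝ := (gaussianReal 0 1).real {t | 1 ≤ |t|}

lemma measurableSet_one_le_abs : MeasurableSet {t : ℝ | 1 ≤ |t|} :=
  measurableSet_le measurable_const (by fun_prop)

lemma gaussianTail_pos : 0 < gaussianTail := by
  refine ENNReal.toReal_pos (fun h => ?_) (by finiteness)
  have h1 := gaussianReal_absolutelyContinuous' 0 (v := 1) one_ne_zero h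
  have h2 : volume (Set.Ici (1 : ℝ)) ≤ 0 := h1 ▸ measure_mono fun t (ht : 1 ≤ t) =>
    show 1 ≤ |t| from ht.trans (le_abs_self t)
  simp at h2

/-- The reflected noise decreases the concave part of the cost at the rate of its concavity, and
increases the quadratic part by at most the variance of the noise. -/
lemma reflectedCost_le (ha : 0 < a) (hε : 0 ≤ ε) {ρ s : ℝ} (hρ : 0 ≤ ρ) (hs : 0 ≤ s)
    (has : a * s ≤ 1) :
    reflectedCost a ε s ρ ≤ oddCost a ε ρ + ε * s ^ 2 ∧
    reflectedCost a ε s ρ ≤ oddCost a ε ρ -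
      (gaussianTail / 4 * (Real.exp (-(a * ρ)) * a ^ 2) - 2 * ε) * (s * min ρ s) := by
  set γ := gaussianReal 0 1
  set D : ℝ → ℝ := fun t =>
    oddExp a (ρ + s * t) + oddExp a (ρ - s * t) - 2 * oddExp a ρ with hD
  set q : ℝ → ℝ := fun t => (ρ + s * t) * |ρ + s * t| + (ρ - s * t) * |ρ - s * t| - 2 * (ρ * |ρ|)
    with hq
  have hneg : reflectedCost a ε s ρ = ∫ t, oddCost a ε (ρ - s * t) ∂γ := by
    have hm : γ.map (fun t => -t) = γ := by simp [γ, gaussianReal_map_neg]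
    have hmeas : Measurable fun t => oddCost a ε (ρ + s * t) :=
      measurable_oddCost.comp (by fun_prop)
    calc ∫ t, oddCost a ε (ρ + s * t) ∂γ
        = ∫ t, oddCost a ε (ρ + s * t) ∂(γ.map fun t => -t) := by rw [hm]
      _ = ∫ t, oddCost a ε (ρ - s * t) ∂γ := by
        rw [integral_map (by fun_prop) hmeas.aestronglyMeasurable]
        simp only [mul_neg, sub_eq_add_neg]
  have hDint : Integrable D γ := by
    have hb : ∀ r : ℝ, Integrable (fun t => oddExp a (ρ + r * t)) γ := fun r => by
      refine Integrable.mono' (integrable_const 1)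
        (measurable_oddExp.comp (by fun_prop)).aestronglyMeasurable ?_
      exact Filter.Eventually.of_forall fun t => abs_oddExp_le ha.le _
    refine ((hb s).add ?_).sub (integrable_const _)
    simpa [sub_eq_add_neg] using hb (-s)
  have hsum : 2 * (reflectedCost a ε s ρ - oddCost a ε ρ) = ∫ t, (D t + ε * q t) ∂γ := by
    have h2 : Integrable (fun t => oddCost a ε (ρ - s * t)) γ := by
      simpa [sub_eq_add_neg] using integrable_oddCost ha.le hε (-s) ρ
    have h1 := integrable_oddCost ha.le hε s ρ
    have : ∀ t, D t + ε * q t = oddCost a ε (ρ + s * t) + oddCost a ε (ρ - s * t) -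
        2 * oddCost a ε ρ := fun t => by simp only [hD, hq, oddCost]; ring
    simp_rw [this]
    rw [integral_sub (f := fun t => oddCost a ε (ρ + s * t) + oddCost a ε (ρ - s * t))
      (h1.add h2) (integrable_const _), integral_add h1 h2, ← hneg, integral_const]
    simp only [probReal_univ, one_smul]
    change _ = reflectedCost a ε s ρ + reflectedCost a ε s ρ - _
    ring
  have hqint : Integrable q γ := by
    have h0 : ∀ r : ℝ, Integrable (fun t => (ρ + r * t) * |ρ + r * t|) γ := fun r => by
      refine Integrable.mono' (memLp_affine_gaussianReal r ρ).integrable_sq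
        (by fun_prop) (Filter.Eventually.of_forall fun t => ?_)
      rw [Real.norm_eq_abs, abs_mul, abs_abs, ← sq, sq_abs]
    refine ((h0 s).add ?_).sub (integrable_const _)
    simpa [sub_eq_add_neg] using h0 (-s)
  rw [integral_add hDint (hqint.const_mul ε), integral_const_mul] at hsum
  have hq1 : ∫ t, q t ∂γ ≤ 2 * s ^ 2 := by
    calc ∫ t, q t ∂γ ≤ ∫ t, 2 * s ^ 2 * t ^ 2 ∂γ :=
          integral_mono hqint (integrable_sq_gaussianReal.const_mul _) fun t => by
            have := (mul_abs_add_sub_le hρ (s * t)).1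
            simp only [hq]; linarith
      _ = 2 * s ^ 2 := by rw [integral_const_mul, integral_sq_gaussianReal, mul_one]
  have hq2 : ∫ t, q t ∂γ ≤ 4 * (ρ * s) := by
    calc ∫ t, q t ∂γ ≤ ∫ t, 4 * (ρ * s) * |t| ∂γ :=
          integral_mono hqint (integrable_abs_gaussianReal.const_mul _) fun t => by
            have := (mul_abs_add_sub_le hρ (s * t)).2
            rw [abs_mul, abs_of_nonneg hs] at this
            simp only [hq]; linarith
      _ ≤ 4 * (ρ * s) := by
        rw [integral_const_mul]
        exact mul_le_of_le_one_right (by positivity) integral_abs_gaussianReal_le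
  have hD0 : ∀ t, D t ≤ 0 := fun t => oddExp_add_sub_nonpos ha.le hρ (s * t)
  set m := 1 / 2 * (Real.exp (-(a * ρ)) * a ^ 2 * (s * min ρ s)) with hm
  have hm0 : 0 ≤ m := by
    have := le_min hρ hs
    positivity
  have hD1 : ∫ t, D t ∂γ ≤ -(gaussianTail * m) := by
    calc ∫ t, D t ∂γ ≤ ∫ t, Set.indicator {t : ℝ | 1 ≤ |t|} (fun _ => -m) t ∂γ := by
          refine integral_mono hDint ((integrable_const _).indicator measurableSet_one_le_abs)
            fun t => ?_
          by_cases ht : 1 ≤ |t|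
          · rw [Set.indicator_of_mem (show t ∈ {t : ℝ | 1 ≤ |t|} from ht)]
            refine oddExp_add_sub_le ha hρ hs has ?_
            rw [abs_mul, abs_of_nonneg hs]
            exact le_mul_of_one_le_right hs ht
          · rw [Set.indicator_of_notMem (show t ∉ {t : ℝ | 1 ≤ |t|} from ht)]
            exact hD0 t
      _ = -(gaussianTail * m) := by
          rw [integral_indicator measurableSet_one_le_abs, setIntegral_const, smul_eq_mul,
            gaussianTail, mul_neg]
  have hD2 : ∫ t, D t ∂γ ≤ 0 := integral_nonpos hD0
  constructor
  · have := mul_le_mul_of_nonneg_left hq1 hε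
    linarith
  · have h3 : ∫ t, q t ∂γ ≤ 4 * (s * min ρ s) := by
      rcases min_cases ρ s with ⟨h, _⟩ | ⟨h, _⟩ <;> rw [h] <;> nlinarith
    have := mul_le_mul_of_nonneg_left h3 hε
    rw [hm] at hD1
    linarith

end ReflectedCost

/-! ### Contraction of the averaged cost -/

section Contraction

lemma oddCost_le_one_add {a ε r : ℝ} (ha : 0 ≤ a) (hr : 0 ≤ r) :
    oddCost a ε r ≤ 1 + ε * r ^ 2 := by
  have := (abs_le.mp (abs_oddExp_le ha r)).2
  rw [oddCost, abs_of_nonneg hr, ← sq]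
  linarith

lemma oddCost_le_mul {a ε r : ℝ} (ha : 0 ≤ a) (hr : 0 ≤ r) :
    oddCost a ε r ≤ a * r + ε * r ^ 2 := by
  have h := oddExp_sub_le ha (x := 0) hr
  rw [show oddExp a 0 = 0 by simp [oddExp], zero_add] at h
  rw [oddCost, abs_of_nonneg hr, ← sq]
  linarith

/-- Contraction of the averaged cost for distances up to `D`, where the drift may expand: the
concavity of the cost, at rate `a`, beats the expansion rate `L`. -/
lemma reflectedCost_le_of_le {a ε c L D h r ρ : ℝ} (ha : 0 < a) (hε : 0 < ε) (hc : 0 < c)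
    (hL : 0 < L) (hh : 0 < h) (hr : 0 ≤ r) (hrD : r ≤ D)
    (hρ : ρ ≤ (1 + h * L) * r)
    (haL : 12 * L * D ≤ gaussianTail * a)
    (hε1 : 2 * ε ≤ gaussianTail / 16 * (Real.exp (-(a * D)) * a ^ 2))
    (hε2 : 3 * ε * L * D ^ 2 ≤ gaussianTail / 12 * (Real.exp (-(a * D)) * a ^ 2))
    (hc1 : c * (1 + ε * D ^ 2) ≤ gaussianTail / 12 * (Real.exp (-(a * D)) * a ^ 2))
    (hh1 : h * L ≤ 1) (hh2 : a * (h * L * D) ≤ 1 / 2) (hh3 : a * (2 * √h) ≤ 1)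
    (hh4 : √h * (a * L + 3 * ε * L * D + c * (a + ε * D)) ≤
      gaussianTail / 8 * (Real.exp (-(a * D)) * a ^ 2)) :
    reflectedCost a ε (2 * √h) ρ ≤ (1 - c * h) * oddCost a ε r := by
  have hg := gaussianTail_pos
  set g := gaussianTail
  set s := 2 * √h with hs
  have hs0 : 0 ≤ s := by positivity
  set δ := h * L * r with hδ
  have hδ0 : 0 ≤ δ := by positivity
  have hρ' : ρ ≤ r + δ := by rw [hδ]; linarith
  set E := Real.exp (-(a * D)) with hE
  set e := Real.exp (-(a * r)) with he
  have he0 : 0 < e := Real.exp_pos _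
  have hEe : E ≤ e := Real.exp_le_exp.mpr (by nlinarith)
  have he1 : e ≤ 1 := Real.exp_le_one_iff.mpr (by nlinarith)
  have hEX : E * a ^ 2 ≤ e * a ^ 2 := by gcongr
  have haδ : a * δ ≤ 1 / 2 := le_trans (by rw [hδ]; gcongr) hh2
  have hee : e / 2 ≤ Real.exp (-(a * (r + δ))) := by
    rw [show -(a * (r + δ)) = -(a * r) + -(a * δ) by ring, Real.exp_add]
    have := Real.add_one_le_exp (-(a * δ))
    nlinarith
  have hJ := (reflectedCost_le ha hε.le (add_nonneg hr hδ0) hs0 hh3).2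
  have hmono := reflectedCost_mono ha.le hε.le s hρ'
  have hmin : s * min r s ≤ s * min (r + δ) s :=
    mul_le_mul_of_nonneg_left (min_le_min_right s (by linarith)) hs0
  have hmin0 : 0 ≤ s * min r s := mul_nonneg hs0 (le_min hr hs0)
  have hcoef : g / 16 * (e * a ^ 2) ≤ g / 4 * (Real.exp (-(a * (r + δ))) * a ^ 2) - 2 * ε := by
    have h1 : g / 4 * (e / 2 * a ^ 2) ≤ g / 4 * (Real.exp (-(a * (r + δ))) * a ^ 2) := by gcongr
    have h2 : g / 16 * (E * a ^ 2) ≤ g / 16 * (e * a ^ 2) := by gcongr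
    linarith
  have hgain : g / 16 * (e * a ^ 2) * (s * min r s) ≤
      (g / 4 * (Real.exp (-(a * (r + δ))) * a ^ 2) - 2 * ε) * (s * min (r + δ) s) :=
    mul_le_mul hcoef hmin hmin0 (le_trans (by positivity) hcoef)
  have hF : oddCost a ε (r + δ) ≤ oddCost a ε r + (a * e * δ + 3 * ε * (h * L) * r ^ 2) := by
    have h1 := oddExp_sub_le_of_nonneg (a := a) hr hδ0
    have h2 : (r + δ) * (r + δ) ≤ r * r + 3 * (h * L) * r ^ 2 := by
      rw [hδ]; nlinarith [mul_nonneg (mul_nonneg hh.le hL.le) (sq_nonneg r)]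
    have h3 := mul_le_mul_of_nonneg_left h2 hε.le
    rw [oddCost, oddCost, abs_of_nonneg hr, abs_of_nonneg (add_nonneg hr hδ0)]
    linarith
  suffices hmain : a * e * δ + 3 * ε * (h * L) * r ^ 2 + c * h * oddCost a ε r ≤
      g / 16 * (e * a ^ 2) * (s * min r s) by linarith
  have hsq : √h * √h = h := Real.mul_self_sqrt hh.le
  rcases le_total s r with hsr | hsr
  · rw [min_eq_right hsr, show s * s = 4 * h by rw [hs]; linarith]
    have h1 : a * e * δ ≤ h * (g / 12 * (e * a ^ 2)) := by
      calc a * e * δ ≤ a * e * (h * L * D) := by rw [hδ]; gcongr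
        _ = h * (a * e / 12) * (12 * L * D) := by ring
        _ ≤ h * (a * e / 12) * (g * a) := by gcongr
        _ = h * (g / 12 * (e * a ^ 2)) := by ring
    have h2 : 3 * ε * (h * L) * r ^ 2 ≤ h * (g / 12 * (e * a ^ 2)) := by
      calc 3 * ε * (h * L) * r ^ 2 ≤ 3 * ε * (h * L) * D ^ 2 := by gcongr
        _ = h * (3 * ε * L * D ^ 2) := by ring
        _ ≤ h * (g / 12 * (E * a ^ 2)) := by gcongr
        _ ≤ _ := by gcongr
    have h3 : c * h * oddCost a ε r ≤ h * (g / 12 * (e * a ^ 2)) := by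
      calc c * h * oddCost a ε r ≤ c * h * (1 + ε * r ^ 2) := by
            have := oddCost_le_one_add (ε := ε) ha.le hr
            gcongr
        _ ≤ c * h * (1 + ε * D ^ 2) := by gcongr
        _ = h * (c * (1 + ε * D ^ 2)) := by ring
        _ ≤ h * (g / 12 * (E * a ^ 2)) := by gcongr
        _ ≤ _ := by gcongr
    linarith
  · rw [min_eq_left hsr]
    have h3 : c * h * oddCost a ε r ≤ c * h * (a * r + ε * r ^ 2) := by
      have := oddCost_le_mul (ε := ε) ha.le hr
      gcongr
    calc a * e * δ + 3 * ε * (h * L) * r ^ 2 + c * h * oddCost a ε r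
        ≤ a * 1 * (h * L * r) + 3 * ε * (h * L) * (r * D) + c * h * (a * r + ε * (r * D)) := by
          have h4 : r ^ 2 ≤ r * D := by rw [sq]; gcongr
          refine add_le_add (add_le_add ?_ ?_) (h3.trans ?_)
          · rw [hδ]; gcongr
          · gcongr
          · gcongr
      _ = r * √h * (√h * (a * L + 3 * ε * L * D + c * (a + ε * D))) := by
          linear_combination (-(r * (a * L + 3 * ε * L * D + c * (a + ε * D)))) * hsq
      _ ≤ r * √h * (g / 8 * (e * a ^ 2)) := by
          refine mul_le_mul_of_nonneg_left (hh4.trans ?_) (by positivity)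
          gcongr
      _ = g / 16 * (e * a ^ 2) * (s * r) := by rw [hs]; ring

/-- Contraction of the averaged cost for distances above `D`, where the drift contracts: the
quadratic part of the cost contracts, and its decrease dominates the bounded concave part. -/
lemma reflectedCost_le_of_ge {a ε c K D h r ρ : ℝ} (ha : 0 < a) (hε : 0 < ε)
    (hK : 0 < K) (hD : 0 < D) (hh : 0 < h) (hρ0 : 0 ≤ ρ) (hrD : D ≤ r)
    (hρ : ρ ^ 2 ≤ (1 - h * K) * r ^ 2) (hKD : 8 ≤ K * D ^ 2)
    (hc0 : 0 < c) (hc1 : c ≤ K / 4) (hc2 : c ≤ ε * K * D ^ 2 / 4) (hh3 : a * (2 * √h) ≤ 1) :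
    reflectedCost a ε (2 * √h) ρ ≤ (1 - c * h) * oddCost a ε r := by
  have hr : 0 ≤ r := hD.le.trans hrD
  have hJ := (reflectedCost_le ha hε.le hρ0 (by positivity) hh3).1
  have hs : (2 * √h) ^ 2 = 4 * h := by rw [mul_pow, Real.sq_sqrt hh.le]; norm_num
  have hρr : ρ ≤ r := abs_le_of_sq_le_sq' (hρ.trans (by nlinarith [mul_pos hh hK, sq_nonneg r])) hr
    |>.2
  have hg := oddExp_mono ha.le hρr
  have hF := oddCost_le_one_add (ε := ε) ha.le hr
  have hDr : D ^ 2 ≤ r ^ 2 := by gcongr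
  have h1 : c * oddCost a ε r ≤ ε * K * r ^ 2 / 2 := by
    calc c * oddCost a ε r ≤ c * (1 + ε * r ^ 2) := by gcongr
      _ = c + c * (ε * r ^ 2) := by ring
      _ ≤ ε * K * D ^ 2 / 4 + K / 4 * (ε * r ^ 2) := by gcongr
      _ ≤ ε * K * r ^ 2 / 4 + K / 4 * (ε * r ^ 2) := by gcongr
      _ = _ := by ring
  have h2 : 4 * ε ≤ ε * K * r ^ 2 / 2 := by nlinarith [mul_le_mul_of_nonneg_left hDr hK.le]
  have h3 := mul_le_mul_of_nonneg_left hρ hε.le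
  rw [hs] at hJ
  have h4 := mul_le_mul_of_nonneg_left (add_le_add h1 h2) hh.le
  have h5 : oddCost a ε ρ ≤ oddCost a ε r - ε * (h * K) * r ^ 2 := by
    rw [oddCost, oddCost, abs_of_nonneg hρ0, abs_of_nonneg hr]
    linarith
  linarith

/-- For suitable parameters of the cost, one step of a map that expands distances `r` at most by
the factor `1 + hL`, and contracts `r²` by the factor `1 - hK` when `r > R`, followed by reflected
Gaussian noise, contracts the cost at a rate proportional to the step size `h`. -/
theorem exists_reflectedCost_contraction {L K R : ℝ} (hL : 0 < L) (hK : 0 < K) (hR : 0 < R) :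
    ∃ a ε c h₀ : ℝ, 0 < a ∧ 0 < ε ∧ 0 < c ∧ 0 < h₀ ∧ ∀ h, 0 < h → h < h₀ → ∀ r ρ, 0 ≤ r → 0 ≤ ρ →
      ρ ≤ (1 + h * L) * r → (R < r → ρ ^ 2 ≤ (1 - h * K) * r ^ 2) →
      reflectedCost a ε (2 * √h) ρ ≤ (1 - c * h) * oddCost a ε r := by
  have hg := gaussianTail_pos
  set g := gaussianTail
  -- Beyond `D` the contraction `h K r²` of the squared distance exceeds the variance of the noise.
  obtain ⟨D, hD, hRD, hKD⟩ : ∃ D, 0 < D ∧ R < D ∧ 8 ≤ K * D ^ 2 := by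
    refine ⟨R + 1 + 8 / K, by positivity, by linarith [div_pos (by norm_num : (0 : ℝ) < 8) hK], ?_⟩
    have h1 : 0 < 8 / K := by positivity
    have h2 : K * (8 / K) = 8 := by field_simp
    calc (8 : ℝ) = K * (8 / K * 1) := by linarith
      _ ≤ K * ((R + 1 + 8 / K) * (R + 1 + 8 / K)) := by gcongr <;> linarith
      _ = _ := by ring
  -- Up to `D`, a concavity of rate `a` outweighs the expansion; then `ε` and `c` are chosen so
  -- small that the quadratic part and the contraction rate use up only a part of the gain.
  obtain ⟨a, ha, haL⟩ : ∃ a, 0 < a ∧ 12 * L * D ≤ g * a :=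
    ⟨12 * L * D / g, by positivity, by rw [mul_div_cancel₀ _ hg.ne']⟩
  set X := Real.exp (-(a * D)) * a ^ 2 with hX
  have hX0 : 0 < X := by positivity
  obtain ⟨ε, hε, hε1, hε2⟩ : ∃ ε, 0 < ε ∧ 2 * ε ≤ g / 16 * X ∧ 3 * ε * L * D ^ 2 ≤ g / 12 * X := by
    refine ⟨min (g / 32 * X) (g / 36 * X / (L * D ^ 2)), by positivity, ?_, ?_⟩
    · linarith [min_le_left (g / 32 * X) (g / 36 * X / (L * D ^ 2))]
    · have h1 := min_le_right (g / 32 * X) (g / 36 * X / (L * D ^ 2))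
      rw [le_div_iff₀ (by positivity)] at h1
      linarith
  obtain ⟨c, hc, hc1, hc2, hc3⟩ : ∃ c, 0 < c ∧ c * (1 + ε * D ^ 2) ≤ g / 12 * X ∧ c ≤ K / 4 ∧
      c ≤ ε * K * D ^ 2 / 4 := by
    refine ⟨min (g / 12 * X / (1 + ε * D ^ 2)) (min (K / 4) (ε * K * D ^ 2 / 4)), by positivity,
      ?_, ?_, ?_⟩
    · rw [← le_div_iff₀ (by positivity)]
      exact min_le_left _ _
    · exact (min_le_right _ _).trans (min_le_left _ _)
    · exact (min_le_right _ _).trans (min_le_right _ _)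
  set B := a * L + 3 * ε * L * D + c * (a + ε * D) with hB
  have hB0 : 0 < B := by positivity
  set θ := min (1 / (2 * a)) (g / 8 * X / B) with hθ
  have hθ0 : 0 < θ := by positivity
  refine ⟨a, ε, c, min (min (1 / L) (1 / 2 / (a * (L * D)))) (θ ^ 2), ha, hε, hc, by positivity,
    fun h hh hlt r ρ hr hρ hρr hcontr => ?_⟩
  have hlt1 : h ≤ 1 / L := hlt.le.trans ((min_le_left _ _).trans (min_le_left _ _))
  have hlt2 : h ≤ 1 / 2 / (a * (L * D)) := hlt.le.trans ((min_le_left _ _).trans (min_le_right _ _))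
  have hlt3 : √h ≤ θ := Real.sqrt_le_iff.mpr ⟨hθ0.le, hlt.le.trans (min_le_right _ _)⟩
  rw [le_div_iff₀ (by positivity)] at hlt1 hlt2
  have hs1 : a * (2 * √h) ≤ 1 := by
    have := hlt3.trans (min_le_left _ _)
    rw [le_div_iff₀ (by positivity)] at this
    linarith
  have hs2 : √h * B ≤ g / 8 * X := by
    rw [← le_div_iff₀ hB0]
    exact hlt3.trans (min_le_right _ _)
  rcases le_total r D with h1 | h1
  · exact reflectedCost_le_of_le ha hε hc hL hh hr h1 hρr haL hε1 hε2 hc1 hlt1 (by linarith) hs1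
      hs2
  · exact reflectedCost_le_of_ge ha hε hK hD hh hρ h1 (hcontr (hRD.trans_le h1)) hKD hc hc2 hc3 hs1

end Contraction

/-! ### Maximal reflection coupling of Gaussian noise -/

section Gaussian

variable {d : ℕ}

lemma stdGaussian_map_inner (w : Eucl d) :
    (stdGaussian (Eucl d)).map (fun z => inner ℝ z w) = gaussianReal 0 (‖w‖₊ ^ 2) := by
  have h := IsGaussian.map_eq_gaussianReal (μ := stdGaussian (Eucl d)) (innerSL ℝ w)
  rw [integral_strongDual_stdGaussian, variance_dual_stdGaussian, innerSL_apply_norm] at h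
  have h1 : (fun z => inner ℝ z w) = innerSL ℝ w := by
    ext z; rw [innerSL_apply_apply, real_inner_comm]
  rw [h1, h]
  congr 1
  ext
  simp

lemma integral_cexp_stdGaussian (t w : Eucl d) :
    ∫ z, Complex.exp (inner ℝ z t * Complex.I - inner ℝ z w) ∂stdGaussian (Eucl d) =
      Complex.exp ((-‖t‖ ^ 2 + ‖w‖ ^ 2) / 2 - inner ℝ w t * Complex.I) := by
  have hterm : ∀ (c : ℂ), ∫ x : ℝ, Complex.exp (c * x) ∂gaussianReal 0 1 =
      Complex.exp (c ^ 2 / 2) := fun c => by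
    have := complexMGF_id_gaussianReal (μ := 0) (v := 1) c
    simpa [complexMGF] using this
  rw [← map_pi_eq_stdGaussian, integral_map (by fun_prop) (by fun_prop)]
  have hprod : ∀ x : Fin d → ℝ,
      Complex.exp (inner ℝ (WithLp.toLp 2 x : Eucl d) t * Complex.I -
        inner ℝ (WithLp.toLp 2 x : Eucl d) w) =
      ∏ i, Complex.exp ((t i * Complex.I - w i) * x i) := fun x => by
    rw [← Complex.exp_sum]
    congr 1
    simp only [PiLp.inner_apply, RCLike.inner_apply, conj_trivial, Complex.ofReal_sum,
      Complex.ofReal_mul, Finset.sum_mul, ← Finset.sum_sub_distrib]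
    exact Finset.sum_congr rfl fun i _ => by ring
  simp_rw [hprod]
  rw [integral_fintype_prod_eq_prod
    (f := fun (i : Fin d) (x : ℝ) => Complex.exp ((t i * Complex.I - w i) * x))]
  simp_rw [hterm]
  rw [← Complex.exp_sum]
  congr 1
  simp only [← Complex.ofReal_pow, EuclideanSpace.real_norm_sq_eq, PiLp.inner_apply,
    RCLike.inner_apply, conj_trivial, Complex.ofReal_sum, Complex.ofReal_mul, Finset.sum_mul,
    ← Finset.sum_neg_distrib, ← Finset.sum_add_distrib, Finset.sum_div, ← Finset.sum_sub_distrib]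
  refine Finset.sum_congr rfl fun i _ => ?_
  push_cast
  linear_combination (t i : ℂ) ^ 2 / 2 * Complex.I_sq

/-- The density ratio `φ(z + w) / φ(z)`, with `φ` the standard Gaussian density. -/
noncomputable def shiftDensity (w z : Eucl d) : ℝ≥0∞ :=
  ENNReal.ofReal (Real.exp (-inner ℝ z w - ‖w‖ ^ 2 / 2))

@[fun_prop]
lemma measurable_shiftDensity (w : Eucl d) : Measurable (shiftDensity w) := by
  unfold shiftDensity; fun_prop

/-- The Cameron–Martin formula for the standard Gaussian measure. -/
lemma lintegral_shiftDensity_mul (w : Eucl d) {G : Eucl d → ℝ≥0∞} (hG : Measurable G) :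
    ∫⁻ z, shiftDensity w z * G (z + w) ∂stdGaussian (Eucl d) =
      ∫⁻ z, G z ∂stdGaussian (Eucl d) := by
  set γ := stdGaussian (Eucl d)
  have hmeas : ((γ.withDensity (shiftDensity w)).map fun z => z + w) = γ := by
    have hfin : IsFiniteMeasure (γ.withDensity (shiftDensity w)) := by
      refine isFiniteMeasure_withDensity_ofReal (Integrable.hasFiniteIntegral ?_)
      have h1 : Integrable (fun x : ℝ => Real.exp (-x - ‖w‖ ^ 2 / 2))
          (γ.map fun z => inner ℝ z w) := by
        rw [stdGaussian_map_inner]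
        have := (integrable_exp_mul_gaussianReal (μ := 0) (v := ‖w‖₊ ^ 2) (-1)).mul_const
          (Real.exp (-(‖w‖ ^ 2 / 2)))
        refine this.congr (Filter.Eventually.of_forall fun x => ?_)
        simp only [← Real.exp_add]
        ring_nf
      exact h1.comp_measurable (by fun_prop)
    refine Measure.ext_of_charFun ?_
    ext t
    rw [charFun_apply, integral_map (by fun_prop) (by fun_prop), charFun_stdGaussian,
      integral_withDensity_eq_integral_toReal_smul (measurable_shiftDensity w)
        (Filter.Eventually.of_forall fun _ => by simp [shiftDensity])]
    have h2 : ∀ z : Eucl d, (shiftDensity w z).toReal •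
        Complex.exp (inner ℝ (z + w) t * Complex.I) =
        Complex.exp (inner ℝ w t * Complex.I - ‖w‖ ^ 2 / 2) *
          Complex.exp (inner ℝ z t * Complex.I - inner ℝ z w) := fun z => by
      rw [shiftDensity, ENNReal.toReal_ofReal (Real.exp_pos _).le, Complex.real_smul,
        Complex.ofReal_exp, ← Complex.exp_add, ← Complex.exp_add, inner_add_left]
      push_cast
      ring_nf
    simp_rw [h2]
    rw [integral_const_mul, integral_cexp_stdGaussian, ← Complex.exp_add]
    ring_nf
  calc ∫⁻ z, shiftDensity w z * G (z + w) ∂γ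
      = ∫⁻ z, G (z + w) ∂(γ.withDensity (shiftDensity w)) := by
        rw [lintegral_withDensity_eq_lintegral_mul _ (by fun_prop) (by fun_prop)]
        rfl
    _ = ∫⁻ z, G z ∂((γ.withDensity (shiftDensity w)).map fun z => z + w) := by
        rw [lintegral_map hG (by fun_prop)]
    _ = _ := by rw [hmeas]

/-- The reflection of `z` in the hyperplane orthogonal to `w` (the identity if `w = 0`). -/
noncomputable def hyperplaneReflection (w z : Eucl d) : Eucl d :=
  z - (2 * (inner ℝ z w / ‖w‖ ^ 2)) • w

lemma hyperplaneReflection_eq (w z : Eucl d) :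
    hyperplaneReflection w z = (Submodule.span ℝ {w})ᗮ.reflection z := by
  rw [Submodule.reflection_orthogonal_apply, Submodule.reflection_singleton_apply,
    hyperplaneReflection, real_inner_comm, mul_smul, two_smul, two_smul]
  simp

lemma stdGaussian_map_hyperplaneReflection (w : Eucl d) :
    (stdGaussian (Eucl d)).map (hyperplaneReflection w) = stdGaussian (Eucl d) := by
  have h : hyperplaneReflection w = ((Submodule.span ℝ {w})ᗮ.reflection : Eucl d → Eucl d) :=
    funext (hyperplaneReflection_eq w)
  rw [h]
  exact stdGaussian_map _

@[fun_prop]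
lemma Measurable.hyperplaneReflection {α : Type*} [MeasurableSpace α] {f g : α → Eucl d}
    (hf : Measurable f) (hg : Measurable g) :
    Measurable fun x => hyperplaneReflection (f x) (g x) := by
  unfold _root_.hyperplaneReflection
  fun_prop

lemma inner_hyperplaneReflection (w z : Eucl d) :
    inner ℝ (hyperplaneReflection w z) w = -inner ℝ z w := by
  rcases eq_or_ne w 0 with rfl | hw
  · simp
  · have : ‖w‖ ^ 2 ≠ 0 := by simpa using hw
    rw [hyperplaneReflection, inner_sub_left, real_inner_smul_left, real_inner_self_eq_norm_sq]
    field_simp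
    ring

/-- The noise coupled to `z`: given `v` uniform in `[0, 1]`, the shift `z + w` is accepted with the
probability `min 1 (φ(z + w) / φ(z))`, and `z` is reflected in the hyperplane orthogonal to `w` if
the shift is rejected. -/
noncomputable def coupledNoise (w z : Eucl d) (v : ℝ) : Eucl d :=
  if v ≤ Real.exp (-inner ℝ z w - ‖w‖ ^ 2 / 2) then z + w else hyperplaneReflection w z

@[fun_prop]
lemma Measurable.coupledNoise {α : Type*} [MeasurableSpace α] {f g : α → Eucl d} {v : α → ℝ}
    (hf : Measurable f) (hg : Measurable g) (hv : Measurable v) :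
    Measurable fun x => coupledNoise (f x) (g x) (v x) :=
  Measurable.ite (measurableSet_le hv (by fun_prop)) (by fun_prop) (by fun_prop)

/-- The uniform distribution on `[0, 1]`. -/
noncomputable def unifMeasure : Measure ℝ := volume.restrict (Set.Icc 0 1)

instance : IsProbabilityMeasure unifMeasure := ⟨by simp [unifMeasure]⟩

lemma lintegral_unifMeasure_ite (c : ℝ) (A B : ℝ≥0∞) :
    ∫⁻ v, (if v ≤ c then A else B) ∂unifMeasure =
      min 1 (ENNReal.ofReal c) * A + (1 - ENNReal.ofReal c) * B := by
  have h1 : unifMeasure (Set.Iic c) = min 1 (ENNReal.ofReal c) := by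
    rw [unifMeasure, Measure.restrict_apply measurableSet_Iic, ← Set.Ici_inter_Iic,
      Set.inter_comm, Set.inter_assoc, Set.Iic_inter_Iic, Set.Ici_inter_Iic, Real.volume_Icc,
      sub_zero, ENNReal.ofReal_min, ENNReal.ofReal_one]
  have h2 : unifMeasure (Set.Iic c)ᶜ = 1 - ENNReal.ofReal c := by
    rw [prob_compl_eq_one_sub measurableSet_Iic, h1]
    rcases le_total 1 (ENNReal.ofReal c) with h | h
    · rw [min_eq_left h, tsub_self, tsub_eq_zero_of_le h]
    · rw [min_eq_right h]
  have h3 : ∫⁻ v in Set.Iic c, (if v ≤ c then A else B) ∂unifMeasure =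
      ∫⁻ _ in Set.Iic c, A ∂unifMeasure :=
    setLIntegral_congr_fun measurableSet_Iic fun v hv => if_pos hv
  have h4 : ∫⁻ v in (Set.Iic c)ᶜ, (if v ≤ c then A else B) ∂unifMeasure =
      ∫⁻ _ in (Set.Iic c)ᶜ, B ∂unifMeasure :=
    setLIntegral_congr_fun measurableSet_Iic.compl fun v hv => if_neg hv
  rw [← lintegral_add_compl _ (measurableSet_Iic (a := c)), h3, h4, setLIntegral_const,
    setLIntegral_const, h1, h2, mul_comm A, mul_comm B]

lemma lintegral_coupledNoise (w z : Eucl d) (G : Eucl d → ℝ≥0∞) :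
    ∫⁻ v, G (coupledNoise w z v) ∂unifMeasure =
      min 1 (shiftDensity w z) * G (z + w) +
        (1 - shiftDensity w z) * G (hyperplaneReflection w z) := by
  simp_rw [coupledNoise, apply_ite G]
  exact lintegral_unifMeasure_ite _ _ _

lemma shiftDensity_mul_neg (w z : Eucl d) :
    shiftDensity w z * shiftDensity (-w) (z + w) = 1 := by
  rw [shiftDensity, shiftDensity, ← ENNReal.ofReal_mul (Real.exp_pos _).le, ← Real.exp_add,
    inner_neg_right, inner_add_left, real_inner_self_eq_norm_sq, norm_neg]
  ring_nf
  simp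

lemma shiftDensity_hyperplaneReflection (w z : Eucl d) :
    shiftDensity w (hyperplaneReflection w z) = shiftDensity (-w) z := by
  rw [shiftDensity, shiftDensity, inner_hyperplaneReflection, inner_neg_right, norm_neg]

lemma lintegral_hyperplaneReflection (w : Eucl d) {G : Eucl d → ℝ≥0∞} (hG : Measurable G) :
    ∫⁻ z, G (hyperplaneReflection w z) ∂stdGaussian (Eucl d) = ∫⁻ z, G z ∂stdGaussian (Eucl d) := by
  conv_rhs => rw [← stdGaussian_map_hyperplaneReflection w]
  rw [lintegral_map hG (by fun_prop)]

/-- The coupled noise is again standard Gaussian: the accepted part has density `min(φ(z), φ(z-w))`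
and the reflected rejected part has density `(φ(z) - φ(z-w))⁺`. -/
lemma lintegral_coupledNoise_eq (w : Eucl d) {G : Eucl d → ℝ≥0∞} (hG : Measurable G) :
    ∫⁻ z, ∫⁻ v, G (coupledNoise w z v) ∂unifMeasure ∂stdGaussian (Eucl d) =
      ∫⁻ z, G z ∂stdGaussian (Eucl d) := by
  simp_rw [lintegral_coupledNoise]
  rw [lintegral_add_left (by fun_prop)]
  have h1 : ∫⁻ z, min 1 (shiftDensity w z) * G (z + w) ∂stdGaussian (Eucl d) =
      ∫⁻ z, min 1 (shiftDensity (-w) z) * G z ∂stdGaussian (Eucl d) := by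
    rw [← lintegral_shiftDensity_mul w (G := fun z => min 1 (shiftDensity (-w) z) * G z)
      (by fun_prop)]
    refine lintegral_congr fun z => ?_
    rw [← mul_assoc, mul_min, shiftDensity_mul_neg, mul_one, min_comm]
  have h2 : ∫⁻ z, (1 - shiftDensity w z) * G (hyperplaneReflection w z) ∂stdGaussian (Eucl d) =
      ∫⁻ z, (1 - shiftDensity (-w) z) * G z ∂stdGaussian (Eucl d) := by
    rw [← lintegral_hyperplaneReflection w (G := fun z => (1 - shiftDensity (-w) z) * G z)
      (by fun_prop)]
    refine lintegral_congr fun z => ?_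
    rw [← shiftDensity_hyperplaneReflection, hyperplaneReflection_eq, hyperplaneReflection_eq,
      Submodule.reflection_reflection]
  rw [h1, h2, ← lintegral_add_left (by fun_prop)]
  refine lintegral_congr fun z => ?_
  rw [← add_mul]
  rcases le_total 1 (shiftDensity (-w) z) with h | h
  · rw [min_eq_left h, tsub_eq_zero_of_le h, add_zero, one_mul]
  · rw [min_eq_right h, add_tsub_cancel_of_le h, one_mul]

lemma stdGaussian_map_neg : (stdGaussian (Eucl d)).map (fun z => -z) = stdGaussian (Eucl d) :=
  stdGaussian_map (LinearIsometryEquiv.neg ℝ)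

lemma lintegral_neg_stdGaussian {G : Eucl d → ℝ≥0∞} (hG : Measurable G) :
    ∫⁻ z, G (-z) ∂stdGaussian (Eucl d) = ∫⁻ z, G z ∂stdGaussian (Eucl d) := by
  conv_rhs => rw [← stdGaussian_map_neg]
  rw [lintegral_map hG (by fun_prop)]

/-- The reflection principle: under the maximal reflection coupling of two Gaussian steps from `x`
and `y` the expected cost is the Gaussian average of the odd extension of the cost. Indeed, a
rejected shift occurs only on the half space where `x` is the nearer point, and there the rejection
density is the difference of the Gaussian density and its reflection. -/
lemma lintegral_coupledNoise_le {a ε h : ℝ} (ha : 0 ≤ a) (hε : 0 ≤ ε) (hh : 0 < h)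
    (x y : Eucl d) :
    ∫⁻ z, ∫⁻ v, ENNReal.ofReal (oddCost a ε
      ‖(x + √h • z) - (y + √h • coupledNoise ((√h)⁻¹ • (x - y)) z v)‖)
        ∂unifMeasure ∂stdGaussian (Eucl d) ≤
      ENNReal.ofReal (reflectedCost a ε (2 * √h) ‖x - y‖) := by
  have hs : 0 < √h := Real.sqrt_pos.mpr hh
  set γ := stdGaussian (Eucl d) with hγ
  obtain ⟨w, hw⟩ : ∃ w, w = (√h)⁻¹ • (x - y) := ⟨_, rfl⟩
  have hxy : x - y = √h • w := by rw [hw, smul_inv_smul₀ hs.ne']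
  have hdiff : ∀ z z' : Eucl d, (x + √h • z) - (y + √h • z') = √h • (w + z - z') := fun z z' => by
    rw [smul_sub, smul_add, ← hxy]; abel
  have hG0 := fun z => lintegral_coupledNoise w z
    (fun z' => ENNReal.ofReal (oddCost a ε ‖(x + √h • z) - (y + √h • z')‖))
  rw [← hw]
  simp_rw [hG0, hdiff]
  have hz0 : ∀ z : Eucl d, w + z - (z + w) = 0 := fun z => by abel
  simp only [hz0, smul_zero, norm_zero, oddCost_zero, ENNReal.ofReal_zero, mul_zero, zero_add]
  rcases eq_or_ne w 0 with rfl | hw0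
  · simp [shiftDensity]
  have hω : 0 < ‖w‖ := norm_pos_iff.mpr hw0
  set p : Eucl d → ℝ := fun z => √h * (‖w‖ + 2 * (inner ℝ z w / ‖w‖)) with hp
  have hpm : Measurable p := by fun_prop
  have hFp : Measurable fun z => oddCost a ε (p z) := measurable_oddCost.comp hpm
  set g : Eucl d → ℝ≥0∞ := fun z => ENNReal.ofReal (oddCost a ε (p z)) with hg
  have hgm : Measurable g := hFp.ennreal_ofReal
  have hpneg : ∀ z, p z ≤ 0 → 1 ≤ shiftDensity w z := fun z hz => by
    rw [shiftDensity, ENNReal.one_le_ofReal]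
    refine Real.one_le_exp ?_
    have h1 : ‖w‖ + 2 * (inner ℝ z w / ‖w‖) ≤ 0 := nonpos_of_mul_nonpos_right hz hs
    have h2 := mul_le_mul_of_nonneg_left h1 hω.le
    have h3 : ‖w‖ * (inner ℝ z w / ‖w‖) = inner ℝ z w := by field_simp
    nlinarith
  have hppos : ∀ z, 0 ≤ p z → shiftDensity w z ≤ 1 := fun z hz => by
    rw [shiftDensity, ENNReal.ofReal_le_one]
    refine Real.exp_le_one_iff.mpr ?_
    have h1 : 0 ≤ ‖w‖ + 2 * (inner ℝ z w / ‖w‖) := nonneg_of_mul_nonneg_right hz hs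
    have h2 := mul_nonneg hω.le h1
    have h3 : ‖w‖ * (inner ℝ z w / ‖w‖) = inner ℝ z w := by field_simp
    nlinarith
  have hg0 : ∀ z, p z ≤ 0 → g z = 0 := fun z hz => by
    rw [hg]
    refine ENNReal.ofReal_of_nonpos ?_
    have := oddCost_mono ha hε hz
    rwa [oddCost_zero] at this
  -- On the event of a rejected shift the new distance is the affine function `p` of the noise.
  have hstep : ∀ z, (1 - shiftDensity w z) *
      ENNReal.ofReal (oddCost a ε ‖√h • (w + z - hyperplaneReflection w z)‖) =
      g z - shiftDensity w z * g z := fun z => by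
    rcases le_total (p z) 0 with hz | hz
    · rw [tsub_eq_zero_of_le (hpneg z hz), hg0 z hz]; simp
    · have h1 : w + z - hyperplaneReflection w z = (1 + 2 * (inner ℝ z w / ‖w‖ ^ 2)) • w := by
        rw [hyperplaneReflection, add_smul, one_smul]; abel
      have h2 : ‖√h • (w + z - hyperplaneReflection w z)‖ = p z := by
        calc ‖√h • (w + z - hyperplaneReflection w z)‖
            = |√h * ((1 + 2 * (inner ℝ z w / ‖w‖ ^ 2)) * ‖w‖)| := by
              rw [h1, norm_smul, norm_smul, Real.norm_eq_abs, Real.norm_eq_abs, abs_mul, abs_mul,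
                abs_norm]
          _ = |p z| := by
              congr 1
              simp only [hp]
              field_simp
          _ = p z := abs_of_nonneg hz
      rw [h2, ENNReal.sub_mul fun _ _ => ENNReal.ofReal_ne_top, one_mul]
  simp_rw [hstep]
  have hint : Integrable (fun z => oddCost a ε (p z)) γ ∧
      ∫ z, oddCost a ε (p z) ∂γ = reflectedCost a ε (2 * √h) ‖x - y‖ := by
    set e := ‖w‖⁻¹ • w with he
    have he1 : ‖e‖ = 1 := by rw [he, norm_smul, norm_inv, norm_norm, inv_mul_cancel₀ hω.ne']
    have hmap : γ.map (fun z => inner ℝ z e) = gaussianReal 0 1 := by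
      rw [hγ, stdGaussian_map_inner]
      congr 1
      ext
      simp [he1]
    have hpe : ∀ z, p z = ‖x - y‖ + 2 * √h * inner ℝ z e := fun z => by
      rw [hp, hxy, norm_smul, Real.norm_of_nonneg hs.le, he, real_inner_smul_right]
      simp only
      field_simp
    have hF := integrable_oddCost ha hε (2 * √h) ‖x - y‖
    have hFm : Measurable fun t : ℝ => oddCost a ε (‖x - y‖ + 2 * √h * t) :=
      measurable_oddCost.comp (by fun_prop)
    simp_rw [hpe]
    rw [reflectedCost, ← hmap]
    rw [← hmap] at hF
    exact ⟨hF.comp_measurable (by fun_prop),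
      (integral_map (by fun_prop) hFm.aestronglyMeasurable).symm⟩
  have hshift : ∫⁻ z, shiftDensity w z * g z ∂γ =
      ∫⁻ z, ENNReal.ofReal (-oddCost a ε (p z)) ∂γ := by
    have hHm : Measurable fun z => ENNReal.ofReal (-oddCost a ε (p z)) := hFp.neg.ennreal_ofReal
    rw [hγ, ← lintegral_neg_stdGaussian hHm,
      ← lintegral_shiftDensity_mul w (G := fun z => ENNReal.ofReal (-oddCost a ε (p (-z))))
        (hHm.comp measurable_neg)]
    refine lintegral_congr fun z => ?_
    have hpz : p (-(z + w)) = -p z := by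
      simp only [hp, inner_neg_left, inner_add_left, real_inner_self_eq_norm_sq]
      field_simp
      ring
    simp only [hg, hpz, oddCost_neg, neg_neg]
  have hfin1 : ∫⁻ z, g z ∂γ ≠ ∞ := hint.1.lintegral_lt_top.ne
  have hfin2 : ∫⁻ z, ENNReal.ofReal (-oddCost a ε (p z)) ∂γ ≠ ∞ := hint.1.neg.lintegral_lt_top.ne
  have hle : ∀ z, shiftDensity w z * g z ≤ g z := fun z => by
    rcases le_total (p z) 0 with hz | hz
    · rw [hg0 z hz, mul_zero]
    · exact mul_le_of_le_one_left' (hppos z hz)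
  rw [lintegral_sub (by fun_prop) (hshift ▸ hfin2) (Filter.Eventually.of_forall hle), hshift,
    ← hint.2, integral_eq_lintegral_pos_part_sub_lintegral_neg_part hint.1,
    ENNReal.ofReal_sub _ ENNReal.toReal_nonneg, ENNReal.ofReal_toReal hfin1,
    ENNReal.ofReal_toReal hfin2]

end Gaussian

/-! ### Gluing of couplings -/

section Wasserstein

variable {d : ℕ}

/-- Couplings with a common marginal can be glued. -/
lemma exists_gluing {μ ν π : Measure (Eucl d)} [IsFiniteMeasure ν]
    {γ₁ γ₂ : Measure (Eucl d × Eucl d)} (h₁ : γ₁ ∈ couplings μ ν) (h₂ : γ₂ ∈ couplings ν π) :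
    ∃ m : Measure ((Eucl d × Eucl d) × Eucl d),
      m.map Prod.fst = γ₁ ∧ m.map (fun z => (z.1.2, z.2)) = γ₂ := by
  have hf₁ : IsFiniteMeasure γ₁ := by
    refine ⟨?_⟩
    have := measure_lt_top ν Set.univ
    rwa [← h₁.2, Measure.map_apply measurable_snd MeasurableSet.univ] at this
  have hf₂ : IsFiniteMeasure γ₂ := by
    refine ⟨?_⟩
    have := measure_lt_top ν Set.univ
    rwa [← h₂.1, Measure.map_apply measurable_fst MeasurableSet.univ] at this
  refine ⟨γ₁ ⊗ₘ (γ₂.condKernel.comap Prod.snd measurable_snd), Measure.fst_compProd _ _, ?_⟩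
  have hdis : ν ⊗ₘ γ₂.condKernel = γ₂ := by
    rw [← h₂.1]
    exact γ₂.disintegrate γ₂.condKernel
  refine Measure.ext_of_lintegral _ fun F hF => ?_
  have hm : Measurable fun x : Eucl d => ∫⁻ y, F (x, y) ∂γ₂.condKernel x :=
    hF.lintegral_kernel_prod_right'
  rw [lintegral_map hF (by fun_prop), Measure.lintegral_compProd (by fun_prop)]
  simp only [Kernel.comap_apply]
  conv_rhs => rw [← hdis]
  rw [Measure.lintegral_compProd hF, ← h₁.2, lintegral_map hm measurable_snd]

/-- The triangle inequality for the Wasserstein distance, with the first distance replaced by the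
cost of a given coupling. -/
lemma wasserstein_le_add {p : ℝ} (hp : 1 ≤ p) {μ ν π : Measure (Eucl d)} [IsFiniteMeasure ν]
    {γ₁ : Measure (Eucl d × Eucl d)} (h₁ : γ₁ ∈ couplings μ ν) :
    wasserstein p μ π ≤ wasserstein p ν π + (∫⁻ z, edist z.1 z.2 ^ p ∂γ₁) ^ (1 / p) := by
  have hp0 : 0 < p := by linarith
  set D := (∫⁻ z, edist z.1 z.2 ^ p ∂γ₁) ^ (1 / p) with hD
  rw [← tsub_le_iff_right]
  conv_rhs => rw [wasserstein]
  rw [one_div, ENNReal.le_rpow_inv_iff hp0]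
  refine le_iInf₂ fun γ₂ h₂ => ?_
  rw [← ENNReal.le_rpow_inv_iff hp0, tsub_le_iff_right, ← one_div]
  obtain ⟨m, hm₁, hm₂⟩ := exists_gluing h₁ h₂
  have hcoup : m.map (fun z => (z.1.1, z.2)) ∈ couplings μ π := by
    constructor
    · rw [Measure.map_map (by fun_prop) (by fun_prop), ← h₁.1, ← hm₁,
        Measure.map_map (by fun_prop) (by fun_prop)]
      rfl
    · rw [Measure.map_map (by fun_prop) (by fun_prop), ← h₂.2, ← hm₂,
        Measure.map_map (by fun_prop) (by fun_prop)]
      rfl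
  have hmeas : Measurable fun z : Eucl d × Eucl d => edist z.1 z.2 ^ p := by fun_prop
  calc wasserstein p μ π
      ≤ (∫⁻ z, edist z.1 z.2 ^ p ∂(m.map fun z => (z.1.1, z.2))) ^ (1 / p) :=
        ENNReal.rpow_le_rpow (iInf₂_le _ hcoup) (by positivity)
    _ = (∫⁻ z, edist z.1.1 z.2 ^ p ∂m) ^ (1 / p) := by rw [lintegral_map hmeas (by fun_prop)]
    _ ≤ (∫⁻ z, (edist z.1.2 z.2 + edist z.1.1 z.1.2) ^ p ∂m) ^ (1 / p) := by
        gcongr with z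
        rw [add_comm]
        exact edist_triangle _ _ _
    _ ≤ (∫⁻ z, edist z.1.2 z.2 ^ p ∂m) ^ (1 / p) + (∫⁻ z, edist z.1.1 z.1.2 ^ p ∂m) ^ (1 / p) :=
        ENNReal.lintegral_Lp_add_le (by fun_prop) (by fun_prop) hp
    _ = _ := by
        rw [hD, ← hm₁, ← hm₂, lintegral_map hmeas (by fun_prop), lintegral_map hmeas (by fun_prop)]

end Wasserstein

/-! ### The laws of the Euler schemes -/

section Independence

variable {Ω α β γ : Type*} [MeasurableSpace Ω] [MeasurableSpace α] [MeasurableSpace β]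
  [MeasurableSpace γ] {P : Measure Ω}

lemma iIndepFun.indepFun_tail {U : ℕ → Ω → α} (hU : ∀ k, AEMeasurable (U k) P)
    (h : iIndepFun U P) (k : ℕ) : IndepFun (U k) (fun ω j => U (k + 1 + j) ω) P := by
  have h' : iIndepFun (fun k => (hU k).mk (U k)) P :=
    (iIndepFun_congr fun k => (hU k).ae_eq_mk).mp h
  have hind : IndepFun ((hU k).mk (U k)) (fun ω j => (hU (k + 1 + j)).mk (U (k + 1 + j)) ω) P := by
    have h1 := indep_iSup_of_disjoint
      (fun i => ((hU i).measurable_mk).comap_le) h'.iIndep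
      (show Disjoint ({k} : Set ℕ) (Set.Ioi k) by simp)
    refine indep_of_indep_of_le h1 ?_ ?_
    · exact le_iSup₂ (f := fun (i : ℕ) (_ : i ∈ ({k} : Set ℕ)) =>
        MeasurableSpace.comap ((hU i).mk (U i)) _) k rfl
    · rw [MeasurableSpace.pi, MeasurableSpace.comap_iSup]
      refine iSup_le fun j => ?_
      rw [MeasurableSpace.comap_comp]
      exact le_iSup₂ (f := fun (i : ℕ) (_ : i ∈ Set.Ioi k) =>
        MeasurableSpace.comap ((hU i).mk (U i)) _) (k + 1 + j) (by simp; omega)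
  refine hind.congr (hU k).ae_eq_mk.symm ?_
  have : ∀ᵐ ω ∂P, ∀ j, U (k + 1 + j) ω = (hU (k + 1 + j)).mk (U (k + 1 + j)) ω :=
    ae_all_iff.mpr fun j => (hU _).ae_eq_mk
  filter_upwards [this] with ω hω
  exact funext fun j => (hω j).symm

variable [IsProbabilityMeasure P]

/-- If `X` is independent of `(A, T)`, and `A` of `T`, then `(X, A)` is independent of `T`. -/
lemma IndepFun.prodMk_left {X : Ω → α} {A : Ω → β} {T : Ω → γ} (hX : AEMeasurable X P)
    (hA : AEMeasurable A P) (hT : AEMeasurable T P) (h : IndepFun X (fun ω => (A ω, T ω)) P)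
    (hAT : IndepFun A T P) : IndepFun (fun ω => (X ω, A ω)) T P := by
  have hXA : IndepFun X A P := h.comp measurable_id measurable_fst
  rw [indepFun_iff_map_prod_eq_prod_map_map (hX.prodMk hA) hT]
  rw [indepFun_iff_map_prod_eq_prod_map_map hX (hA.prodMk hT)] at h
  rw [indepFun_iff_map_prod_eq_prod_map_map hX hA] at hXA
  rw [indepFun_iff_map_prod_eq_prod_map_map hA hT] at hAT
  rw [hXA]
  have : P.map (fun ω => ((X ω, A ω), T ω)) =
      (P.map fun ω => (X ω, (A ω, T ω))).map MeasurableEquiv.prodAssoc.symm := by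
    rw [AEMeasurable.map_map_of_aemeasurable (by fun_prop) (hX.prodMk (hA.prodMk hT))]
    rfl
  have hprob1 := Measure.isProbabilityMeasure_map hX
  have hprob2 := Measure.isProbabilityMeasure_map hA
  have hprob3 := Measure.isProbabilityMeasure_map hT
  rw [this, h, hAT]
  exact ((measurePreserving_prodAssoc _ _ _).symm _).map_eq

/-- If the pairs `(A, A')` and `(B, B')` are independent, and each pair has independent entries,
then `(A, B)` and `(A', B')` are independent. -/
lemma IndepFun.prodMk_prodMk_comm {α' β' : Type*} [MeasurableSpace α'] [MeasurableSpace β']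
    {A : Ω → α} {A' : Ω → α'} {B : Ω → β} {B' : Ω → β'} (hA : AEMeasurable A P)
    (hA' : AEMeasurable A' P) (hB : AEMeasurable B P) (hB' : AEMeasurable B' P)
    (h : IndepFun (fun ω => (A ω, A' ω)) (fun ω => (B ω, B' ω)) P) (hAA : IndepFun A A' P)
    (hBB : IndepFun B B' P) :
    IndepFun (fun ω => (A ω, B ω)) (fun ω => (A' ω, B' ω)) P := by
  have h1 : IndepFun (fun ω => ((B ω, B' ω), A' ω)) A P :=
    IndepFun.prodMk_left (hB.prodMk hB') hA' hA (h.symm.comp measurable_id measurable_swap) hAA.symm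
  have h2 : IndepFun (fun ω => (A' ω, B' ω)) B P :=
    IndepFun.prodMk_left hA' hB' hB
      (h.comp measurable_snd measurable_swap) hBB.symm
  refine IndepFun.prodMk_left hA hB (hA'.prodMk hB') ?_ h2.symm
  exact h1.symm.comp (ψ := fun z => (z.1.1, (z.2, z.1.2))) measurable_id (by fun_prop)

end Independence

section Law

variable {d n : ℕ}

/-- The law after one step of the Euler scheme with drift estimator `bbar(·, U)`, `U ∼ ν`, and step
size `h`, started with the law `m`. -/
noncomputable def eulerStep (bbar : Eucl d → Eucl n → Eucl d) (ν : Measure (Eucl n)) (h : ℝ)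
    (m : Measure (Eucl d)) : Measure (Eucl d) :=
  ((m.prod ν).prod (stdGaussian (Eucl d))).map
    fun q => q.1.1 + h • bbar q.1.1 q.1.2 + √h • q.2

variable {bbar : Eucl d → Eucl n → Eucl d} {ν : Measure (Eucl n)} {h : ℝ}

lemma measurable_drift_comp (hb : Measurable (Function.uncurry bbar)) {α : Type*}
    [MeasurableSpace α] {f : α → Eucl d} {g : α → Eucl n} (hf : Measurable f) (hg : Measurable g) :
    Measurable fun x => bbar (f x) (g x) := hb.comp (hf.prodMk hg)

lemma measurable_step (hb : Measurable (Function.uncurry bbar)) :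
    Measurable fun q : (Eucl d × Eucl n) × Eucl d =>
      q.1.1 + h • bbar q.1.1 q.1.2 + √h • q.2 := by
  have := measurable_drift_comp hb (f := fun q : (Eucl d × Eucl n) × Eucl d => q.1.1)
    (g := fun q => q.1.2) (by fun_prop) (by fun_prop)
  fun_prop

lemma lintegral_eulerStep [IsProbabilityMeasure ν] (hb : Measurable (Function.uncurry bbar))
    (m : Measure (Eucl d)) [SFinite m] {F : Eucl d → ℝ≥0∞} (hF : Measurable F) :
    ∫⁻ x, F x ∂eulerStep bbar ν h m =
      ∫⁻ x, ∫⁻ u, ∫⁻ z, F (x + h • bbar x u + √h • z) ∂stdGaussian (Eucl d) ∂ν ∂m := by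
  have hm : Measurable fun q : (Eucl d × Eucl n) × Eucl d =>
      F (q.1.1 + h • bbar q.1.1 q.1.2 + √h • q.2) := hF.comp (measurable_step hb)
  rw [eulerStep, lintegral_map hF (measurable_step hb), lintegral_prod _ hm.aemeasurable,
    lintegral_prod _ hm.lintegral_prod_right'.aemeasurable]

lemma isProbabilityMeasure_eulerStep [IsProbabilityMeasure ν]
    (hb : Measurable (Function.uncurry bbar)) (m : Measure (Eucl d)) [IsProbabilityMeasure m] :
    IsProbabilityMeasure (eulerStep bbar ν h m) :=
  Measure.isProbabilityMeasure_map (measurable_step hb).aemeasurable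

variable {Ω : Type*} [MeasurableSpace Ω] {P : Measure Ω}
  {μ₀ : Measure (Eucl d)} {ξ X : ℕ → Ω → Eucl d} {U : ℕ → Ω → Eucl n}

lemma IsRandomisedEulerScheme.aemeasurable (hb : Measurable (Function.uncurry bbar))
    (hX : IsRandomisedEulerScheme bbar ν h μ₀ P ξ U X) (k : ℕ) : AEMeasurable (X k) P := by
  induction k with
  | zero => exact hX.law_zero.aemeasurable
  | succ k ih =>
    have h1 : AEMeasurable (fun ω => ((X k ω, U k ω), ξ k ω)) P :=
      (ih.prodMk (hX.law_U k).aemeasurable).prodMk (hX.law_noise k).aemeasurable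
    exact ((measurable_step (h := h) hb).comp_aemeasurable h1).congr
      ((hX.step k).mono fun _ h => h.symm)

variable [IsProbabilityMeasure P]

/-- The state at time `k` is independent of the randomness used from time `k` on. -/
lemma IsRandomisedEulerScheme.indepFun_future (hb : Measurable (Function.uncurry bbar))
    (hX : IsRandomisedEulerScheme bbar ν h μ₀ P ξ U X) (k : ℕ) :
    IndepFun (U k) (ξ k) P ∧
    IndepFun (X k) (fun ω => ((U k ω, ξ k ω),
      ((fun j => U (k + 1 + j) ω), (fun j => ξ (k + 1 + j) ω)))) P := by
  have hU : ∀ k, AEMeasurable (U k) P := fun k => (hX.law_U k).aemeasurable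
  have hξ : ∀ k, AEMeasurable (ξ k) P := fun k => (hX.law_noise k).aemeasurable
  have hUt : ∀ k, AEMeasurable (fun ω j => U (k + 1 + j) ω) P := fun k =>
    aemeasurable_pi_iff.mpr fun j => hU _
  have hξt : ∀ k, AEMeasurable (fun ω j => ξ (k + 1 + j) ω) P := fun k =>
    aemeasurable_pi_iff.mpr fun j => hξ _
  refine ⟨hX.indep_U_noise.comp (measurable_pi_apply k) (measurable_pi_apply k), ?_⟩
  induction k with
  | zero =>
    exact hX.indep_zero.comp measurable_id
      (ψ := fun s => ((s.1 0, s.2 0), ((fun j => s.1 (0 + 1 + j)), (fun j => s.2 (0 + 1 + j)))))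
      (by fun_prop)
  | succ k ih =>
    have h1 : IndepFun (fun ω => (U k ω, ξ k ω))
        (fun ω => ((fun j => U (k + 1 + j) ω), (fun j => ξ (k + 1 + j) ω))) P := by
      refine IndepFun.prodMk_prodMk_comm (hU k) (hUt k) (hξ k) (hξt k) ?_
        (iIndepFun.indepFun_tail hU hX.indep_U k) (iIndepFun.indepFun_tail hξ hX.indep_noise k)
      exact hX.indep_U_noise.comp (φ := fun s => (s k, fun j => s (k + 1 + j)))
        (ψ := fun s => (s k, fun j => s (k + 1 + j))) (by fun_prop) (by fun_prop)
    have h2 := IndepFun.prodMk_left (hX.aemeasurable hb k) ((hU k).prodMk (hξ k))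
      ((hUt k).prodMk (hξt k)) ih h1
    have h3 := h2.comp (φ := fun q : Eucl d × (Eucl n × Eucl d) =>
        q.1 + h • bbar q.1 q.2.1 + √h • q.2.2)
      (ψ := fun s => ((s.1 0, s.2 0), ((fun j => s.1 (1 + j)), (fun j => s.2 (1 + j)))))
      (by have := measurable_drift_comp hb (f := fun q : Eucl d × (Eucl n × Eucl d) => q.1)
            (g := fun q => q.2.1) (by fun_prop) (by fun_prop)
          fun_prop) (by fun_prop)
    refine h3.congr ((hX.step k).mono fun _ h => h.symm) (Filter.Eventually.of_forall fun ω => ?_)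
    simp only [Function.comp, add_zero, add_assoc]

lemma IsRandomisedEulerScheme.map_succ (hb : Measurable (Function.uncurry bbar))
    (hX : IsRandomisedEulerScheme bbar ν h μ₀ P ξ U X) (k : ℕ) :
    P.map (X (k + 1)) = eulerStep bbar ν h (P.map (X k)) := by
  have hXk := hX.aemeasurable hb k
  have hU := (hX.law_U k).aemeasurable
  have hξ := (hX.law_noise k).aemeasurable
  obtain ⟨h1, h2⟩ := hX.indepFun_future hb k
  have h3 : IndepFun (X k) (fun ω => (U k ω, ξ k ω)) P := h2.comp measurable_id measurable_fst
  have h4 : IndepFun (fun ω => (X k ω, U k ω)) (ξ k) P :=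
    IndepFun.prodMk_left hXk hU hξ h3 h1
  have h5 : IndepFun (X k) (U k) P := h3.comp measurable_id measurable_fst
  rw [indepFun_iff_map_prod_eq_prod_map_map (hXk.prodMk hU) hξ] at h4
  rw [indepFun_iff_map_prod_eq_prod_map_map hXk hU] at h5
  rw [eulerStep, ← (hX.law_U k).map_eq, ← (hX.law_noise k).map_eq, ← h5, ← h4,
    AEMeasurable.map_map_of_aemeasurable (measurable_step hb).aemeasurable
      ((hXk.prodMk hU).prodMk hξ)]
  exact Measure.map_congr (hX.step k)

/-- The law after `k` steps of the Euler scheme started with the law `μ₀`. -/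
noncomputable def eulerLaw (bbar : Eucl d → Eucl n → Eucl d) (ν : Measure (Eucl n)) (h : ℝ)
    (μ₀ : Measure (Eucl d)) (k : ℕ) : Measure (Eucl d) := (eulerStep bbar ν h)^[k] μ₀

lemma eulerLaw_succ (k : ℕ) :
    eulerLaw bbar ν h μ₀ (k + 1) = eulerStep bbar ν h (eulerLaw bbar ν h μ₀ k) :=
  Function.iterate_succ_apply' _ _ _

lemma isProbabilityMeasure_eulerLaw [IsProbabilityMeasure ν] [IsProbabilityMeasure μ₀]
    (hb : Measurable (Function.uncurry bbar)) (k : ℕ) :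
    IsProbabilityMeasure (eulerLaw bbar ν h μ₀ k) := by
  induction k with
  | zero => assumption
  | succ k ih => rw [eulerLaw_succ]; exact isProbabilityMeasure_eulerStep hb _

lemma IsRandomisedEulerScheme.map_eq (hb : Measurable (Function.uncurry bbar))
    (hX : IsRandomisedEulerScheme bbar ν h μ₀ P ξ U X) (k : ℕ) :
    P.map (X k) = eulerLaw bbar ν h μ₀ k := by
  induction k with
  | zero => exact hX.law_zero.map_eq
  | succ k ih => rw [hX.map_succ hb, ih, eulerLaw_succ]

lemma eulerStep_const_eq {b : Eucl d → Eucl d} (hb : Measurable b) (ν ν' : Measure (Eucl n))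
    [IsProbabilityMeasure ν] [IsProbabilityMeasure ν'] (m : Measure (Eucl d)) [SFinite m] :
    eulerStep (fun x _ => b x) ν h m = eulerStep (fun x _ => b x) ν' h m := by
  have hb' : Measurable (Function.uncurry fun (x : Eucl d) (_ : Eucl n) => b x) :=
    hb.comp measurable_fst
  refine Measure.ext_of_lintegral _ fun F hF => ?_
  rw [lintegral_eulerStep hb' m hF, lintegral_eulerStep hb' m hF]
  simp

/-- The Euler scheme is the Euler scheme with the deterministic drift estimator, for any law `ν` of
the then irrelevant randomisation. -/
lemma IsEulerScheme.map_eq {b : Eucl d → Eucl d} (hb : Measurable b) (ν : Measure (Eucl n))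
    [IsProbabilityMeasure ν] [IsProbabilityMeasure μ₀] (hX : IsEulerScheme b h μ₀ P ξ X) (k : ℕ) :
    P.map (X k) = eulerLaw (fun x _ => b x) ν h μ₀ k := by
  have hb' : Measurable (Function.uncurry fun (x : Eucl d) (_ : Eucl n) => b x) :=
    hb.comp measurable_fst
  have hconst : iIndepFun (fun (_ : ℕ) (_ : Ω) => (0 : Eucl n)) P := by
    rw [iIndepFun_iff_map_fun_eq_infinitePi_map (by fun_prop)]
    simp [Measure.map_const, Measure.infinitePi_dirac]
  have hX' : IsRandomisedEulerScheme (fun x _ => b x) (Measure.dirac (0 : Eucl n)) h μ₀ P ξ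
      (fun _ _ => 0) X :=
    { law_zero := hX.law_zero
      law_noise := hX.law_noise
      law_U := fun _ => ⟨by fun_prop, by simp [Measure.map_const]⟩
      indep_noise := hX.indep_noise
      indep_U := hconst
      indep_U_noise := indepFun_const_left _ _
      indep_zero := hX.indep_zero.comp measurable_id (ψ := fun s => ((fun _ => 0), s))
        (by fun_prop)
      step := hX.step }
  rw [hX'.map_eq hb' k]
  induction k with
  | zero => rfl
  | succ k ih =>
    have := isProbabilityMeasure_eulerLaw (ν := ν) (h := h) (μ₀ := μ₀) hb' k
    rw [eulerLaw_succ, eulerLaw_succ, ih, eulerStep_const_eq hb _ ν]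

end Law

/-! ### Estimates for one step of the drift -/

section Drift

variable {d : ℕ} {b : Eucl d → Eucl d} {L K R h : ℝ}

lemma ContractiveAtInfinity.measurable (hb : ContractiveAtInfinity b L K R) : Measurable b := by
  have : LipschitzWith ⟨L, hb.L_pos.le⟩ b :=
    LipschitzWith.of_dist_le_mul fun x y => by
      rw [dist_eq_norm, dist_eq_norm]
      exact hb.lipschitz x y
  exact this.continuous.measurable

lemma ContractiveAtInfinity.norm_step_sub_le (hb : ContractiveAtInfinity b L K R) (hh : 0 < h)
    (x y : Eucl d) :
    ‖(x + h • b x) - (y + h • b y)‖ ≤ (1 + h * L) * ‖x - y‖ := by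
  calc ‖(x + h • b x) - (y + h • b y)‖ = ‖(x - y) + h • (b x - b y)‖ := by
        rw [smul_sub]; congr 1; abel
    _ ≤ ‖x - y‖ + h * ‖b x - b y‖ := by
        refine (norm_add_le _ _).trans ?_
        rw [norm_smul, Real.norm_of_nonneg hh.le]
    _ ≤ ‖x - y‖ + h * (L * ‖x - y‖) := by
        have := hb.lipschitz x y
        gcongr
    _ = _ := by ring

lemma ContractiveAtInfinity.sq_norm_step_sub_le (hb : ContractiveAtInfinity b L K R) (hh : 0 < h)
    (hL : h * L ^ 2 ≤ K) {x y : Eucl d} (hxy : R < ‖x - y‖) :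
    ‖(x + h • b x) - (y + h • b y)‖ ^ 2 ≤ (1 - h * K) * ‖x - y‖ ^ 2 := by
  have h1 : (x + h • b x) - (y + h • b y) = (x - y) + h • (b x - b y) := by
    rw [smul_sub]; abel
  have h2 := hb.contractive x y hxy
  have h3 : ‖b x - b y‖ ^ 2 ≤ L ^ 2 * ‖x - y‖ ^ 2 := by
    rw [← mul_pow]
    have := hb.lipschitz x y
    gcongr
  rw [h1, norm_add_sq_real, real_inner_smul_right, norm_smul, Real.norm_of_nonneg hh.le, mul_pow]
  have h4 : h ^ 2 * ‖b x - b y‖ ^ 2 ≤ h * K * ‖x - y‖ ^ 2 := by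
    calc h ^ 2 * ‖b x - b y‖ ^ 2 ≤ h ^ 2 * (L ^ 2 * ‖x - y‖ ^ 2) := by gcongr
      _ = h * (h * L ^ 2) * ‖x - y‖ ^ 2 := by ring
      _ ≤ h * K * ‖x - y‖ ^ 2 := by gcongr
  nlinarith [mul_le_mul_of_nonneg_left h2 hh.le]

lemma sq_norm_add_smul_le {θ : ℝ} (hθ : 0 < θ) (hh : 0 < h) (u v : Eucl d) :
    ‖u + h • v‖ ^ 2 ≤ (1 + h * θ) * ‖u‖ ^ 2 + (h ^ 2 + h / θ) * ‖v‖ ^ 2 := by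
  have h1 : ‖u + h • v‖ ≤ ‖u‖ + h * ‖v‖ := by
    refine (norm_add_le _ _).trans ?_
    rw [norm_smul, Real.norm_of_nonneg hh.le]
  have h2 : 2 * (‖u‖ * ‖v‖) ≤ θ * ‖u‖ ^ 2 + ‖v‖ ^ 2 / θ := by
    have h3 : θ * ‖u‖ ^ 2 + ‖v‖ ^ 2 / θ - 2 * (‖u‖ * ‖v‖) = (θ * ‖u‖ - ‖v‖) ^ 2 / θ := by
      field_simp
      ring
    have : 0 ≤ (θ * ‖u‖ - ‖v‖) ^ 2 / θ := by positivity
    linarith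
  calc ‖u + h • v‖ ^ 2 ≤ (‖u‖ + h * ‖v‖) ^ 2 := by gcongr
    _ = ‖u‖ ^ 2 + h * (2 * (‖u‖ * ‖v‖)) + h ^ 2 * ‖v‖ ^ 2 := by ring
    _ ≤ ‖u‖ ^ 2 + h * (θ * ‖u‖ ^ 2 + ‖v‖ ^ 2 / θ) + h ^ 2 * ‖v‖ ^ 2 := by gcongr
    _ = _ := by ring

/-- Dissipativity of one step with a perturbed drift. -/
lemma ContractiveAtInfinity.sq_norm_step_le (hb : ContractiveAtInfinity b L K R) (hh : 0 < h)
    (hL1 : h * L ≤ 1) (hL : h * L ^ 2 ≤ K) (x v : Eucl d) :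
    ‖x + h • v‖ ^ 2 ≤ (1 - h * (K / 2)) * ‖x‖ ^ 2 +
      h * ((1 + h * (K / 2)) * (K + 3 * L) * R ^ 2 + 2 * (h + 2 / K) * ‖b 0‖ ^ 2) +
      2 * h * (h + 2 / K) * ‖v - b x‖ ^ 2 := by
  have hK := hb.K_pos
  have hLp := hb.L_pos
  set u := (x + h • b x) - (0 + h • b 0) with hu
  have hu2 : ‖u‖ ^ 2 ≤ (1 - h * K) * ‖x‖ ^ 2 + h * (K + 3 * L) * R ^ 2 := by
    rcases lt_or_ge R ‖x‖ with hx | hx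
    · have h1 := hb.sq_norm_step_sub_le hh hL (x := x) (y := 0) (by simpa using hx)
      rw [sub_zero] at h1
      have : 0 ≤ h * (K + 3 * L) * R ^ 2 := by positivity
      linarith
    · have h1 := hb.norm_step_sub_le hh x 0
      rw [sub_zero] at h1
      have h2 : ‖u‖ ^ 2 ≤ (1 + h * L) ^ 2 * ‖x‖ ^ 2 := by
        rw [← mul_pow]; gcongr
      have h3 : (1 + h * L) ^ 2 ≤ 1 + 3 * (h * L) := by
        nlinarith [mul_pos hh hLp]
      have h4 : ‖x‖ ^ 2 ≤ R ^ 2 := by gcongr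
      calc ‖u‖ ^ 2 ≤ (1 + 3 * (h * L)) * ‖x‖ ^ 2 := h2.trans (by gcongr)
        _ = (1 - h * K) * ‖x‖ ^ 2 + h * (K + 3 * L) * ‖x‖ ^ 2 := by ring
        _ ≤ _ := by gcongr
  have hxv : x + h • v = u + h • (b 0 + (v - b x)) := by
    rw [hu, smul_add, smul_sub]; abel
  have hv : ‖b 0 + (v - b x)‖ ^ 2 ≤ 2 * ‖b 0‖ ^ 2 + 2 * ‖v - b x‖ ^ 2 := by
    have := norm_add_le (b 0) (v - b x)
    nlinarith [sq_nonneg (‖b 0‖ - ‖v - b x‖), norm_nonneg (b 0 + (v - b x)), norm_nonneg (b 0),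
      norm_nonneg (v - b x)]
  have h5 := sq_norm_add_smul_le (θ := K / 2) (by positivity) hh u (b 0 + (v - b x))
  rw [hxv]
  have h6 : (1 + h * (K / 2)) * (1 - h * K) ≤ 1 - h * (K / 2) := by
    nlinarith [mul_pos hh hK]
  calc ‖u + h • (b 0 + (v - b x))‖ ^ 2
      ≤ (1 + h * (K / 2)) * ((1 - h * K) * ‖x‖ ^ 2 + h * (K + 3 * L) * R ^ 2) +
        (h ^ 2 + h / (K / 2)) * (2 * ‖b 0‖ ^ 2 + 2 * ‖v - b x‖ ^ 2) := h5.trans (by gcongr)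
    _ = (1 + h * (K / 2)) * (1 - h * K) * ‖x‖ ^ 2 +
        (h * ((1 + h * (K / 2)) * (K + 3 * L) * R ^ 2 + 2 * (h + 2 / K) * ‖b 0‖ ^ 2) +
        2 * h * (h + 2 / K) * ‖v - b x‖ ^ 2) := by
        field_simp
        ring
    _ ≤ _ := by
        rw [add_assoc]
        gcongr

end Drift

/-! ### Uniform second moments -/

section Moments

variable {d n : ℕ}

lemma enorm_sq_eq_ofReal (x : Eucl d) : ‖x‖ₑ ^ 2 = ENNReal.ofReal (‖x‖ ^ 2) := by
  rw [ENNReal.ofReal_pow (norm_nonneg x), ofReal_norm]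

lemma lintegral_sq_stdGaussian_lt_top : ∫⁻ z, ‖z‖ₑ ^ 2 ∂stdGaussian (Eucl d) < ∞ := by
  have h := (IsGaussian.memLp_two_id (μ := stdGaussian (Eucl d))).integrable_norm_pow (by norm_num)
  refine lt_of_eq_of_lt (lintegral_congr fun z => ?_) h.lintegral_lt_top
  rw [enorm_sq_eq_ofReal]; rfl

/-- The second moment of a Gaussian step, by the parallelogram law and the symmetry of the
Gaussian law. -/
lemma lintegral_sq_add_smul_stdGaussian {h : ℝ} (hh : 0 ≤ h) (w : Eucl d) :
    ∫⁻ z, ‖w + √h • z‖ₑ ^ 2 ∂stdGaussian (Eucl d) =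
      ‖w‖ₑ ^ 2 + ENNReal.ofReal h * ∫⁻ z, ‖z‖ₑ ^ 2 ∂stdGaussian (Eucl d) := by
  set γ := stdGaussian (Eucl d)
  have h1 : ∫⁻ z, ‖w + √h • (-z)‖ₑ ^ 2 ∂γ = ∫⁻ z, ‖w + √h • z‖ₑ ^ 2 ∂γ :=
    lintegral_neg_stdGaussian (G := fun z => ‖w + √h • z‖ₑ ^ 2) (by fun_prop)
  have h2 : ∀ z : Eucl d, ‖w + √h • z‖ₑ ^ 2 + ‖w + √h • (-z)‖ₑ ^ 2 =
      2 * (‖w‖ₑ ^ 2 + ENNReal.ofReal h * ‖z‖ₑ ^ 2) := fun z => by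
    have htwo : ∀ r : ℝ, 2 * ENNReal.ofReal r = ENNReal.ofReal (2 * r) := fun r => by
      rw [ENNReal.ofReal_mul zero_le_two, ENNReal.ofReal_ofNat]
    simp only [enorm_sq_eq_ofReal]
    rw [← ENNReal.ofReal_mul hh, ← ENNReal.ofReal_add (by positivity) (by positivity),
      ← ENNReal.ofReal_add (by positivity) (by positivity), htwo]
    congr 1
    have := parallelogram_law_with_norm ℝ w (√h • z)
    rw [norm_smul, Real.norm_of_nonneg (Real.sqrt_nonneg h)] at this
    rw [smul_neg, ← sub_eq_add_neg]
    have hs : √h * √h = h := Real.mul_self_sqrt hh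
    rw [this, mul_pow, sq √h, hs]
  have h3 : 2 * ∫⁻ z, ‖w + √h • z‖ₑ ^ 2 ∂γ =
      2 * (‖w‖ₑ ^ 2 + ENNReal.ofReal h * ∫⁻ z, ‖z‖ₑ ^ 2 ∂γ) := by
    calc 2 * ∫⁻ z, ‖w + √h • z‖ₑ ^ 2 ∂γ
        = ∫⁻ z, (‖w + √h • z‖ₑ ^ 2 + ‖w + √h • (-z)‖ₑ ^ 2) ∂γ := by
          rw [lintegral_add_left (by fun_prop), h1, two_mul]
      _ = _ := by
          simp_rw [h2]
          rw [lintegral_const_mul _ (by fun_prop), lintegral_add_left (by fun_prop),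
            lintegral_const_mul _ (by fun_prop)]
          simp
  exact (ENNReal.mul_right_inj (by norm_num) (by norm_num)).mp h3

lemma ofReal_affine_le {q B : ℝ} (hq0 : 0 ≤ q) (hq1 : q ≤ 1) (hB : 0 ≤ B) {A : ℝ≥0∞}
    (hA : A ≤ ENNReal.ofReal B) :
    ENNReal.ofReal (1 - q) * A + ENNReal.ofReal (q * B) ≤ ENNReal.ofReal B := by
  calc ENNReal.ofReal (1 - q) * A + ENNReal.ofReal (q * B)
      ≤ ENNReal.ofReal (1 - q) * ENNReal.ofReal B + ENNReal.ofReal (q * B) := by gcongr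
    _ = ENNReal.ofReal B := by
      rw [← ENNReal.ofReal_mul (by linarith), ← ENNReal.ofReal_add
        (mul_nonneg (by linarith) hB) (by positivity)]
      ring_nf

lemma exists_rpow_le {α τ : ℝ} (hα : 0 < α) (hτ : 0 < τ) :
    ∃ h₀ : ℝ, 0 < h₀ ∧ ∀ h, 0 < h → h < h₀ → h ^ α ≤ τ := by
  refine ⟨τ ^ α⁻¹, by positivity, fun h hh hlt => ?_⟩
  calc h ^ α ≤ (τ ^ α⁻¹) ^ α := by gcongr
    _ = τ := Real.rpow_inv_rpow hτ.le hα.ne'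

lemma isDriftEstimator_self {b : Eucl d → Eucl d} (hb : Measurable b) (ν : Measure (Eucl n))
    [IsProbabilityMeasure ν] (σ α h : ℝ) : IsDriftEstimator b (fun x _ => b x) ν σ α h where
  measurable := hb.comp measurable_fst
  integrable := fun x => integrable_const _
  unbiased := fun x => by simp
  variance_le := fun x => by simp

/-- The second moments of the Euler schemes are bounded uniformly in time, in small step sizes and
in the drift estimator. -/
lemma exists_moment_bound {b : Eucl d → Eucl d} {L K R : ℝ} (hb : ContractiveAtInfinity b L K R)
    {σ α : ℝ} (hσ : 0 < σ) (hα : 0 < α) {μ₀ : Measure (Eucl d)}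
    (hμ₀ : MemLp id 2 μ₀) [IsProbabilityMeasure μ₀] :
    ∃ M h₀ : ℝ, 0 ≤ M ∧ 0 < h₀ ∧ ∀ h, 0 < h → h < h₀ → ∀ (n : ℕ) (bbar : Eucl d → Eucl n → Eucl d)
      (ν : Measure (Eucl n)), IsProbabilityMeasure ν → IsDriftEstimator b bbar ν σ α h →
      ∀ k, ∫⁻ x, ‖x‖ₑ ^ 2 ∂eulerLaw bbar ν h μ₀ k ≤ ENNReal.ofReal M := by
  have hK := hb.K_pos
  have hL := hb.L_pos
  set G := (∫⁻ z, ‖z‖ₑ ^ 2 ∂stdGaussian (Eucl d)).toReal with hG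
  have hG' : ∫⁻ z, ‖z‖ₑ ^ 2 ∂stdGaussian (Eucl d) = ENNReal.ofReal G :=
    (ENNReal.ofReal_toReal lintegral_sq_stdGaussian_lt_top.ne).symm
  set C := (1 + K / 2) * (K + 3 * L) * R ^ 2 + 2 * (1 + 2 / K) * ‖b 0‖ ^ 2 + K / 4 + G with hC
  have hC0 : 0 ≤ C := by positivity
  have hM0 : ∫⁻ x, ‖x‖ₑ ^ 2 ∂μ₀ ≠ ∞ := by
    have h := hμ₀.integrable_norm_pow (by norm_num)
    refine (lt_of_eq_of_lt (lintegral_congr fun z => ?_) h.lintegral_lt_top).ne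
    rw [enorm_sq_eq_ofReal]; rfl
  set M := max (∫⁻ x, ‖x‖ₑ ^ 2 ∂μ₀).toReal (C / (K / 4)) with hM
  have hMC : C ≤ K / 4 * M := by
    have := le_max_right (∫⁻ x, ‖x‖ₑ ^ 2 ∂μ₀).toReal (C / (K / 4))
    rw [← hM, div_le_iff₀ (by positivity)] at this
    linarith
  have hMnn : 0 ≤ M := ENNReal.toReal_nonneg.trans (le_max_left _ _)
  obtain ⟨h₁, hh₁, hα₁⟩ := exists_rpow_le (τ := K / 4 / (2 * (1 + 2 / K) * σ ^ 2)) hα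
    (by positivity)
  refine ⟨M, min h₁ (min 1 (min (1 / L) (min (K / L ^ 2) (4 / K)))), hMnn, by positivity, ?_⟩
  intro h hh hlt n bbar ν hν hest k
  simp only [lt_min_iff] at hlt
  obtain ⟨hlt1, hlt2, hlt3, hlt4, hlt5⟩ := hlt
  rw [lt_div_iff₀ (by positivity)] at hlt3 hlt4 hlt5
  have hτ := hα₁ h hh hlt1
  rw [le_div_iff₀ (by positivity)] at hτ
  have hvar : ∀ x : Eucl d, ∫⁻ u, ‖x + h • bbar x u‖ₑ ^ 2 ∂ν ≤
      ENNReal.ofReal (1 - h * (K / 4)) * ‖x‖ₑ ^ 2 + ENNReal.ofReal (h * (C - G)) := by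
    intro x
    set A := (1 - h * (K / 2)) * ‖x‖ ^ 2 +
      h * ((1 + h * (K / 2)) * (K + 3 * L) * R ^ 2 + 2 * (h + 2 / K) * ‖b 0‖ ^ 2) with hA
    set B := 2 * h * (h + 2 / K) with hB
    have hB0 : 0 ≤ B := by positivity
    have hA0 : 0 ≤ A := by
      have := hb.sq_norm_step_le hh hlt3.le hlt4.le x (b x)
      rw [sub_self, norm_zero] at this
      have h2 := sq_nonneg ‖x + h • b x‖
      rw [hA]
      linarith
    have hbm : Measurable fun u => bbar x u :=
      measurable_drift_comp hest.measurable measurable_const measurable_id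
    have hstep : A + B * (σ ^ 2 * (1 + ‖x‖ ^ 2) * h ^ α) ≤
        (1 - h * (K / 4)) * ‖x‖ ^ 2 + h * (C - G) := by
      have h1 : B * (σ ^ 2 * (1 + ‖x‖ ^ 2) * h ^ α) ≤ h * (K / 4) * (1 + ‖x‖ ^ 2) := by
        calc B * (σ ^ 2 * (1 + ‖x‖ ^ 2) * h ^ α)
            ≤ 2 * h * (1 + 2 / K) * (σ ^ 2 * (1 + ‖x‖ ^ 2) * h ^ α) := by rw [hB]; gcongr
          _ = h * (h ^ α * (2 * (1 + 2 / K) * σ ^ 2)) * (1 + ‖x‖ ^ 2) := by ring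
          _ ≤ h * (K / 4) * (1 + ‖x‖ ^ 2) := by gcongr
      have h2 : h * ((1 + h * (K / 2)) * (K + 3 * L) * R ^ 2 + 2 * (h + 2 / K) * ‖b 0‖ ^ 2) ≤
          h * ((1 + 1 * (K / 2)) * (K + 3 * L) * R ^ 2 + 2 * (1 + 2 / K) * ‖b 0‖ ^ 2) := by gcongr
      rw [hA, hC]
      linarith
    calc ∫⁻ u, ‖x + h • bbar x u‖ₑ ^ 2 ∂ν
        ≤ ∫⁻ u, (ENNReal.ofReal A + ENNReal.ofReal B * ‖bbar x u - b x‖ₑ ^ 2) ∂ν := by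
          refine lintegral_mono fun u => ?_
          simp only [enorm_sq_eq_ofReal]
          rw [← ENNReal.ofReal_mul hB0, ← ENNReal.ofReal_add hA0 (by positivity)]
          exact ENNReal.ofReal_le_ofReal (hb.sq_norm_step_le hh hlt3.le hlt4.le x (bbar x u))
      _ = ENNReal.ofReal A + ENNReal.ofReal B * ∫⁻ u, ‖bbar x u - b x‖ₑ ^ 2 ∂ν := by
          rw [lintegral_add_left measurable_const, lintegral_const_mul _ (by fun_prop)]
          simp
      _ ≤ ENNReal.ofReal A + ENNReal.ofReal B *
            ENNReal.ofReal (σ ^ 2 * (1 + ‖x‖ ^ 2) * h ^ α) := by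
          gcongr
          exact hest.variance_le x
      _ = ENNReal.ofReal (A + B * (σ ^ 2 * (1 + ‖x‖ ^ 2) * h ^ α)) := by
          rw [← ENNReal.ofReal_mul hB0, ← ENNReal.ofReal_add hA0 (by positivity)]
      _ ≤ ENNReal.ofReal ((1 - h * (K / 4)) * ‖x‖ ^ 2 + h * (C - G)) :=
          ENNReal.ofReal_le_ofReal hstep
      _ ≤ _ := by
          rw [enorm_sq_eq_ofReal, ← ENNReal.ofReal_mul (by linarith)]
          exact ENNReal.ofReal_add_le
  induction k with
  | zero => exact (ENNReal.le_ofReal_iff_toReal_le hM0 hMnn).mpr (le_max_left _ _)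
  | succ k ih =>
    have hprob := isProbabilityMeasure_eulerLaw (ν := ν) (h := h) (μ₀ := μ₀) hest.measurable k
    set m := eulerLaw bbar ν h μ₀ k
    rw [eulerLaw_succ, lintegral_eulerStep hest.measurable m (by fun_prop)]
    have hCG : 0 ≤ C - G := by rw [hC]; simp only [add_sub_cancel_right]; positivity
    calc ∫⁻ x, ∫⁻ u, ∫⁻ z, ‖x + h • bbar x u + √h • z‖ₑ ^ 2 ∂stdGaussian (Eucl d) ∂ν ∂m
        = ∫⁻ x, (∫⁻ u, ‖x + h • bbar x u‖ₑ ^ 2 ∂ν) + ENNReal.ofReal (h * G) ∂m := by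
          refine lintegral_congr fun x => ?_
          simp_rw [lintegral_sq_add_smul_stdGaussian hh.le]
          rw [lintegral_add_right _ measurable_const, hG', ← ENNReal.ofReal_mul hh.le]
          simp
      _ ≤ ∫⁻ x, (ENNReal.ofReal (1 - h * (K / 4)) * ‖x‖ₑ ^ 2 + ENNReal.ofReal (h * C)) ∂m := by
          refine lintegral_mono fun x => ?_
          refine (add_le_add_left (hvar x) _).trans (le_of_eq ?_)
          rw [add_assoc, ← ENNReal.ofReal_add (by positivity) (by positivity)]
          ring_nf
      _ = ENNReal.ofReal (1 - h * (K / 4)) * ∫⁻ x, ‖x‖ₑ ^ 2 ∂m + ENNReal.ofReal (h * C) := by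
          rw [lintegral_add_right _ measurable_const, lintegral_const_mul _ (by fun_prop)]
          simp
      _ ≤ ENNReal.ofReal (1 - h * (K / 4)) * ∫⁻ x, ‖x‖ₑ ^ 2 ∂m +
            ENNReal.ofReal (h * (K / 4) * M) := by
          rw [mul_assoc]
          gcongr
      _ ≤ _ := ofReal_affine_le (by positivity) (by linarith) hMnn ih

end Moments

/-! ### Coupling of the two Euler schemes -/

section Coupling

variable {d n : ℕ}

/-- One step of the coupled Euler schemes, with independent inputs: the states `(x, y)`, the
randomisation `u` of the drift in the first scheme, the Gaussian noise `z` and the uniform variable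
`v` of the reflection coupling. -/
noncomputable def coupledStep (bbar : Eucl d → Eucl n → Eucl d) (b : Eucl d → Eucl d) (h : ℝ)
    (q : ((Eucl d × Eucl d) × Eucl n) × (Eucl d × ℝ)) : Eucl d × Eucl d :=
  (q.1.1.1 + h • bbar q.1.1.1 q.1.2 + √h • q.2.1,
    q.1.1.2 + h • b q.1.1.2 + √h • coupledNoise
      ((√h)⁻¹ • ((q.1.1.1 + h • bbar q.1.1.1 q.1.2) - (q.1.1.2 + h • b q.1.1.2))) q.2.1 q.2.2)

variable {bbar : Eucl d → Eucl n → Eucl d} {b : Eucl d → Eucl d} {ν : Measure (Eucl n)} {h : ℝ}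

lemma measurable_coupledStep (hbbar : Measurable (Function.uncurry bbar)) (hb : Measurable b) :
    Measurable (coupledStep bbar b h) := by
  have := measurable_drift_comp hbbar
    (f := fun q : ((Eucl d × Eucl d) × Eucl n) × (Eucl d × ℝ) => q.1.1.1)
    (g := fun q => q.1.2) (by fun_prop) (by fun_prop)
  unfold coupledStep
  fun_prop

/-- The law of one step of the coupled Euler schemes, started with the joint law `γ`. -/
noncomputable def coupledLaw (bbar : Eucl d → Eucl n → Eucl d) (b : Eucl d → Eucl d)
    (ν : Measure (Eucl n)) (h : ℝ) (γ : Measure (Eucl d × Eucl d)) : Measure (Eucl d × Eucl d) :=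
  ((γ.prod ν).prod ((stdGaussian (Eucl d)).prod unifMeasure)).map (coupledStep bbar b h)

lemma lintegral_coupledLaw [IsProbabilityMeasure ν] (hbbar : Measurable (Function.uncurry bbar))
    (hb : Measurable b) (γ : Measure (Eucl d × Eucl d)) [SFinite γ]
    {F : Eucl d × Eucl d → ℝ≥0∞} (hF : Measurable F) :
    ∫⁻ p, F p ∂coupledLaw bbar b ν h γ =
      ∫⁻ p, ∫⁻ u, ∫⁻ z, ∫⁻ v, F (coupledStep bbar b h ((p, u), (z, v)))
        ∂unifMeasure ∂stdGaussian (Eucl d) ∂ν ∂γ := by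
  have hm : Measurable fun q => F (coupledStep bbar b h q) :=
    hF.comp (measurable_coupledStep hbbar hb)
  rw [coupledLaw, lintegral_map hF (measurable_coupledStep hbbar hb),
    lintegral_prod _ hm.aemeasurable, lintegral_prod _ hm.lintegral_prod_right'.aemeasurable]
  refine lintegral_congr fun p => lintegral_congr fun u => ?_
  exact lintegral_prod _ (hm.comp measurable_prodMk_left).aemeasurable

lemma coupledLaw_mem_couplings [IsProbabilityMeasure ν]
    (hbbar : Measurable (Function.uncurry bbar)) (hb : Measurable b) {m m' : Measure (Eucl d)}
    [IsProbabilityMeasure m] [IsProbabilityMeasure m'] {γ : Measure (Eucl d × Eucl d)}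
    [IsProbabilityMeasure γ] (hγ : γ ∈ couplings m m') :
    coupledLaw bbar b ν h γ ∈
      couplings (eulerStep bbar ν h m) (eulerStep (fun x _ => b x) ν h m') := by
  have hb' : Measurable (Function.uncurry fun (x : Eucl d) (_ : Eucl n) => b x) :=
    hb.comp measurable_fst
  constructor
  · refine Measure.ext_of_lintegral _ fun F hF => ?_
    have h1 : Measurable fun q : (Eucl d × Eucl n) × Eucl d =>
        F (q.1.1 + h • bbar q.1.1 q.1.2 + √h • q.2) := hF.comp (measurable_step hbbar)
    rw [lintegral_map hF measurable_fst, lintegral_coupledLaw hbbar hb γ (by fun_prop),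
      lintegral_eulerStep hbbar m hF, ← hγ.1,
      lintegral_map h1.lintegral_prod_right'.lintegral_prod_right' measurable_fst]
    simp [coupledStep]
  · refine Measure.ext_of_lintegral _ fun F hF => ?_
    have h1 : Measurable fun q : (Eucl d × Eucl n) × Eucl d =>
        F (q.1.1 + h • b q.1.1 + √h • q.2) := hF.comp (by fun_prop)
    rw [lintegral_map hF measurable_snd, lintegral_coupledLaw hbbar hb γ (by fun_prop),
      lintegral_eulerStep hb' m' hF, ← hγ.2,
      lintegral_map h1.lintegral_prod_right'.lintegral_prod_right' measurable_snd]
    refine lintegral_congr fun p => lintegral_congr fun u => ?_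
    have h2 : Measurable fun z' => F (p.2 + h • b p.2 + √h • z') := hF.comp (by fun_prop)
    have h3 := lintegral_coupledNoise_eq
      ((√h)⁻¹ • ((p.1 + h • bbar p.1 u) - (p.2 + h • b p.2))) h2
    simp only [coupledStep]
    exact h3

lemma lintegral_oddCost_coupledLaw_le [IsProbabilityMeasure ν] {a ε : ℝ} (ha : 0 ≤ a) (hε : 0 ≤ ε)
    (hh : 0 < h) (hbbar : Measurable (Function.uncurry bbar)) (hb : Measurable b)
    (γ : Measure (Eucl d × Eucl d)) [SFinite γ] :
    ∫⁻ p, ENNReal.ofReal (oddCost a ε ‖p.1 - p.2‖) ∂coupledLaw bbar b ν h γ ≤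
      ∫⁻ p, ∫⁻ u, ENNReal.ofReal (reflectedCost a ε (2 * √h)
        ‖(p.1 + h • bbar p.1 u) - (p.2 + h • b p.2)‖) ∂ν ∂γ := by
  have hF : Measurable fun p : Eucl d × Eucl d => ENNReal.ofReal (oddCost a ε ‖p.1 - p.2‖) :=
    (measurable_oddCost.comp (by fun_prop)).ennreal_ofReal
  rw [lintegral_coupledLaw hbbar hb γ hF]
  refine lintegral_mono fun p => lintegral_mono fun u => ?_
  simp only [coupledStep]
  exact lintegral_coupledNoise_le ha hε hh _ _

/-- The cost of one coupled step: the exact drifts contract the cost, and the error of the drift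
estimator, of size `h ^ (α / 2)`, enters multiplied with `h`. -/
lemma lintegral_reflectedCost_le {a ε c L K R σ α x₀ : ℝ} (ha : 0 < a) (hε : 0 < ε)
    (hb : ContractiveAtInfinity b L K R) (hσ : 0 < σ) (hα : 0 < α) (hh : 0 < h) (hh1 : h ≤ 1)
    (hL1 : h * L ≤ 1) (hc : 0 ≤ 1 - c * h) [IsProbabilityMeasure ν]
    (hest : IsDriftEstimator b bbar ν σ α h) (x y : Eucl d)
    (hx₀ : x₀ = 3 * ((a + 4 * ε) * σ + 2 * ε * σ ^ 2))
    (hcontr : reflectedCost a ε (2 * √h) ‖(x + h • b x) - (y + h • b y)‖ ≤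
      (1 - c * h) * oddCost a ε ‖x - y‖) :
    ∫⁻ u, ENNReal.ofReal (reflectedCost a ε (2 * √h)
        ‖(x + h • bbar x u) - (y + h • b y)‖) ∂ν ≤
      ENNReal.ofReal (1 - c * h) * ENNReal.ofReal (oddCost a ε ‖x - y‖) +
        ENNReal.ofReal (h * h ^ (α / 2) * x₀ * (1 + ‖x‖ ^ 2 + ‖y‖ ^ 2)) := by
  have hL := hb.L_pos
  set ρ := ‖(x + h • b x) - (y + h • b y)‖ with hρ
  set η := h ^ (α / 2) with hη
  have hη0 : 0 < η := Real.rpow_pos_of_pos hh _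
  have hη1 : η ≤ 1 := Real.rpow_le_one hh.le hh1 (by positivity)
  have hη2 : h ^ α = η ^ 2 := by
    rw [hη, ← Real.rpow_natCast, ← Real.rpow_mul hh.le]; norm_num
  set X := 1 + ‖x‖ + ‖y‖ with hX
  have hx0 := norm_nonneg x
  have hy0 := norm_nonneg y
  have hX1 : 1 ≤ X := by linarith
  -- `t` bounds the standard deviation of the drift estimator at `x`.
  set t := σ * η * X with ht
  have ht0 : 0 < t := by positivity
  have hV : σ ^ 2 * (1 + ‖x‖ ^ 2) * h ^ α ≤ t ^ 2 := by
    rw [hη2, ht]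
    have : 1 + ‖x‖ ^ 2 ≤ X ^ 2 := by
      rw [hX]
      linarith [mul_nonneg hx0 hy0, sq_nonneg ‖y‖]
    calc σ ^ 2 * (1 + ‖x‖ ^ 2) * η ^ 2 ≤ σ ^ 2 * X ^ 2 * η ^ 2 := by gcongr
      _ = _ := by ring
  set A := a + 2 * ε * (ρ + 2 * √h) with hA
  have hA0 : 0 < A := by positivity
  have hAX : A ≤ (a + 4 * ε) * X := by
    have h1 : ρ ≤ 2 * (‖x‖ + ‖y‖) := by
      calc ρ ≤ (1 + h * L) * ‖x - y‖ := hb.norm_step_sub_le hh x y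
        _ ≤ (1 + 1) * (‖x‖ + ‖y‖) := by
          gcongr
          exact norm_sub_le x y
        _ = _ := by ring
    have h2 : √h ≤ 1 := Real.sqrt_le_one.mpr hh1
    have h3 : 2 * ε * (ρ + 2 * √h) ≤ 2 * ε * (2 * X) := by
      gcongr
      rw [hX]
      linarith
    have h4 : a ≤ a * X := le_mul_of_one_le_right ha.le hX1
    rw [hA]
    linarith
  have hpt : ∀ u, reflectedCost a ε (2 * √h) ‖(x + h • bbar x u) - (y + h • b y)‖ ≤
      (1 - c * h) * oddCost a ε ‖x - y‖ + A * h * t / 2 +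
        (A * h / (2 * t) + 2 * ε * h ^ 2) * ‖bbar x u - b x‖ ^ 2 := fun u => by
    set e := ‖bbar x u - b x‖ with he
    have hnorm : ‖(x + h • bbar x u) - (y + h • b y)‖ ≤ ρ + h * e := by
      have h1 : (x + h • bbar x u) - (y + h • b y) =
          ((x + h • b x) - (y + h • b y)) + h • (bbar x u - b x) := by
        rw [smul_sub]; abel
      rw [h1]
      refine (norm_add_le _ _).trans ?_
      rw [norm_smul, Real.norm_of_nonneg hh.le]
    have he0 : 0 ≤ e := norm_nonneg _
    have h2 := reflectedCost_mono ha.le hε.le (2 * √h) hnorm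
    have h3 := reflectedCost_add_le ha.le hε.le (s := 2 * √h) (ρ := ρ) (δ := h * e)
      (by positivity) (norm_nonneg _) (by positivity)
    -- Young's inequality `e ≤ (t + e² / t) / 2` replaces the Cauchy–Schwarz inequality.
    have h4 : e ≤ t / 2 + e ^ 2 / (2 * t) := by
      have h5 : t / 2 + e ^ 2 / (2 * t) - e = (t - e) ^ 2 / (2 * t) := by
        field_simp
        ring
      have : 0 ≤ (t - e) ^ 2 / (2 * t) := by positivity
      linarith
    have h5 : A * h * e ≤ A * h * (t / 2 + e ^ 2 / (2 * t)) := by gcongr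
    calc _ ≤ (1 - c * h) * oddCost a ε ‖x - y‖ +
          (a * (h * e) + 2 * ε * (h * e) * (ρ + 2 * √h + h * e)) := by linarith
      _ = (1 - c * h) * oddCost a ε ‖x - y‖ + A * h * e + 2 * ε * h ^ 2 * e ^ 2 := by
          rw [hA]; ring
      _ ≤ (1 - c * h) * oddCost a ε ‖x - y‖ + A * h * (t / 2 + e ^ 2 / (2 * t)) +
          2 * ε * h ^ 2 * e ^ 2 := by gcongr
      _ = _ := by ring
  have hF0 : 0 ≤ oddCost a ε ‖x - y‖ := oddCost_nonneg ha.le hε.le (norm_nonneg _)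
  set B := A * h / (2 * t) + 2 * ε * h ^ 2 with hB
  have hB0 : 0 ≤ B := by positivity
  have hbm : Measurable fun u => bbar x u :=
    measurable_drift_comp hest.measurable measurable_const measurable_id
  have hfinal : A * h * t / 2 + B * t ^ 2 ≤ h * η * x₀ * (1 + ‖x‖ ^ 2 + ‖y‖ ^ 2) := by
    have h1 : A * h * t / 2 + B * t ^ 2 = h * (A * t) + 2 * ε * h ^ 2 * t ^ 2 := by
      rw [hB]
      field_simp
      ring
    have h2 : A * t ≤ (a + 4 * ε) * X * t := by gcongr
    have h3 : 2 * ε * h ^ 2 * t ^ 2 ≤ 2 * ε * h * (σ ^ 2 * η * X ^ 2) := by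
      rw [ht]
      have h4 : h ^ 2 ≤ h := pow_le_of_le_one hh.le hh1 two_ne_zero
      have h5 : η ^ 2 ≤ η := pow_le_of_le_one hη0.le hη1 two_ne_zero
      calc 2 * ε * h ^ 2 * (σ * η * X) ^ 2 = 2 * ε * h ^ 2 * (σ ^ 2 * η ^ 2 * X ^ 2) := by ring
        _ ≤ _ := by gcongr
    have h6 : X ^ 2 ≤ 3 * (1 + ‖x‖ ^ 2 + ‖y‖ ^ 2) := by
      rw [hX]
      linarith [sq_nonneg (1 - ‖x‖), sq_nonneg (1 - ‖y‖), sq_nonneg (‖x‖ - ‖y‖)]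
    calc A * h * t / 2 + B * t ^ 2 = h * (A * t) + 2 * ε * h ^ 2 * t ^ 2 := h1
      _ ≤ h * ((a + 4 * ε) * X * t) + 2 * ε * h * (σ ^ 2 * η * X ^ 2) := by gcongr
      _ = h * η * ((a + 4 * ε) * σ + 2 * ε * σ ^ 2) * X ^ 2 := by rw [ht]; ring
      _ ≤ h * η * ((a + 4 * ε) * σ + 2 * ε * σ ^ 2) * (3 * (1 + ‖x‖ ^ 2 + ‖y‖ ^ 2)) := by gcongr
      _ = _ := by rw [hx₀]; ring
  have hD0 : 0 ≤ (1 - c * h) * oddCost a ε ‖x - y‖ + A * h * t / 2 := by positivity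
  calc ∫⁻ u, ENNReal.ofReal (reflectedCost a ε (2 * √h)
        ‖(x + h • bbar x u) - (y + h • b y)‖) ∂ν
      ≤ ∫⁻ u, (ENNReal.ofReal ((1 - c * h) * oddCost a ε ‖x - y‖ + A * h * t / 2) +
          ENNReal.ofReal B * ‖bbar x u - b x‖ₑ ^ 2) ∂ν := by
        refine lintegral_mono fun u => ?_
        rw [enorm_sq_eq_ofReal, ← ENNReal.ofReal_mul hB0, ← ENNReal.ofReal_add hD0 (by positivity)]
        exact ENNReal.ofReal_le_ofReal (hpt u)
    _ = ENNReal.ofReal ((1 - c * h) * oddCost a ε ‖x - y‖ + A * h * t / 2) +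
          ENNReal.ofReal B * ∫⁻ u, ‖bbar x u - b x‖ₑ ^ 2 ∂ν := by
        rw [lintegral_add_left measurable_const, lintegral_const_mul _ (by fun_prop)]
        simp
    _ ≤ ENNReal.ofReal ((1 - c * h) * oddCost a ε ‖x - y‖ + A * h * t / 2) +
          ENNReal.ofReal B * ENNReal.ofReal (t ^ 2) := by
        gcongr
        exact (hest.variance_le x).trans (ENNReal.ofReal_le_ofReal hV)
    _ = ENNReal.ofReal ((1 - c * h) * oddCost a ε ‖x - y‖ + (A * h * t / 2 + B * t ^ 2)) := by
        rw [← ENNReal.ofReal_mul hB0, ← ENNReal.ofReal_add hD0 (by positivity), add_assoc]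
    _ ≤ ENNReal.ofReal ((1 - c * h) * oddCost a ε ‖x - y‖ +
          h * η * x₀ * (1 + ‖x‖ ^ 2 + ‖y‖ ^ 2)) := by gcongr
    _ ≤ _ := by
        rw [← ENNReal.ofReal_mul hc]
        exact ENNReal.ofReal_add_le

/-- Uniformly in time there is a coupling of the two Euler schemes of cost `O(h ^ (α / 2))`. -/
theorem exists_coupling_eulerLaw {L K R : ℝ} (hb : ContractiveAtInfinity b L K R) {σ α : ℝ}
    (hσ : 0 < σ) (hα : 0 < α) (μ₀ : Measure (Eucl d)) [IsProbabilityMeasure μ₀]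
    (hμ₀ : MemLp id 2 μ₀) :
    ∃ a ε C h₀ : ℝ, 0 < a ∧ 0 < ε ∧ 0 < C ∧ 0 < h₀ ∧ ∀ h, 0 < h → h < h₀ →
      ∀ (n : ℕ) (bbar : Eucl d → Eucl n → Eucl d) (ν : Measure (Eucl n)),
      IsProbabilityMeasure ν → IsDriftEstimator b bbar ν σ α h → ∀ k,
      ∃ γ ∈ couplings (eulerLaw bbar ν h μ₀ k) (eulerLaw (fun x _ => b x) ν h μ₀ k),
        ∫⁻ p, ENNReal.ofReal (oddCost a ε ‖p.1 - p.2‖) ∂γ ≤ ENNReal.ofReal (C * h ^ (α / 2)) := by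
  have hL := hb.L_pos
  have hK := hb.K_pos
  obtain ⟨a, ε, c, h₁, ha, hε, hc, hh₁, hcontr⟩ :=
    exists_reflectedCost_contraction hb.L_pos hb.K_pos hb.R_pos
  obtain ⟨M, h₂, hM0, hh₂, hM⟩ := exists_moment_bound hb hσ hα hμ₀
  obtain ⟨x₀, hx₀⟩ : ∃ x₀, x₀ = 3 * ((a + 4 * ε) * σ + 2 * ε * σ ^ 2) := ⟨_, rfl⟩
  have hx₀pos : 0 < x₀ := by rw [hx₀]; positivity
  refine ⟨a, ε, x₀ * (1 + 2 * M) / c,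
    min h₁ (min h₂ (min 1 (min (1 / L) (min (K / L ^ 2) (1 / c))))),
    ha, hε, by positivity, by positivity, ?_⟩
  intro h hh hlt n bbar ν hν hest k
  simp only [lt_min_iff] at hlt
  obtain ⟨hlt1, hlt2, hlt3, hlt4, hlt5, hlt6⟩ := hlt
  rw [lt_div_iff₀ (by positivity)] at hlt4 hlt5 hlt6
  have hbm := hb.measurable
  have hself := isDriftEstimator_self hbm ν σ α h
  set B := x₀ * (1 + 2 * M) / c * h ^ (α / 2) with hB
  have hB0 : 0 ≤ B := by positivity
  suffices H : ∃ γ ∈ couplings (eulerLaw bbar ν h μ₀ k) (eulerLaw (fun x _ => b x) ν h μ₀ k),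
      ∫⁻ p, ENNReal.ofReal (oddCost a ε ‖p.1 - p.2‖) ∂γ ≤ ENNReal.ofReal B from H
  induction k with
  | zero =>
    have hdiag : Measurable fun x : Eucl d => (x, x) := by fun_prop
    have hF : Measurable fun p : Eucl d × Eucl d => ENNReal.ofReal (oddCost a ε ‖p.1 - p.2‖) :=
      (measurable_oddCost.comp (by fun_prop)).ennreal_ofReal
    refine ⟨μ₀.map fun x => (x, x), ⟨?_, ?_⟩, ?_⟩
    · rw [Measure.map_map measurable_fst hdiag]; exact Measure.map_id
    · rw [Measure.map_map measurable_snd hdiag]; exact Measure.map_id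
    · rw [lintegral_map hF hdiag]
      simp [oddCost_zero]
  | succ k ih =>
    obtain ⟨γ, hγ, hcost⟩ := ih
    have hp1 := isProbabilityMeasure_eulerLaw (ν := ν) (h := h) (μ₀ := μ₀) hest.measurable k
    have hp2 := isProbabilityMeasure_eulerLaw (ν := ν) (h := h) (μ₀ := μ₀) hself.measurable k
    have hM1 := hM h hh hlt2 n bbar ν hν hest k
    have hM2 := hM h hh hlt2 n _ ν hν hself k
    have hγp : IsProbabilityMeasure γ := by
      refine ⟨?_⟩
      have := hp1.measure_univ
      rwa [← hγ.1, Measure.map_apply measurable_fst MeasurableSet.univ] at this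
    refine ⟨coupledLaw bbar b ν h γ, ?_, ?_⟩
    · rw [eulerLaw_succ, eulerLaw_succ]
      exact coupledLaw_mem_couplings hest.measurable hbm hγ
    rw [← hγ.1, lintegral_map (by fun_prop) measurable_fst] at hM1
    rw [← hγ.2, lintegral_map (by fun_prop) measurable_snd] at hM2
    have hF : Measurable fun p : Eucl d × Eucl d => ENNReal.ofReal (oddCost a ε ‖p.1 - p.2‖) :=
      (measurable_oddCost.comp (by fun_prop)).ennreal_ofReal
    set κ := h * h ^ (α / 2) * x₀ with hκ
    have hκ0 : 0 ≤ κ := by positivity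
    have hmom : ∫⁻ p : Eucl d × Eucl d, ENNReal.ofReal (κ * (1 + ‖p.1‖ ^ 2 + ‖p.2‖ ^ 2)) ∂γ ≤
        ENNReal.ofReal (c * h * B) := by
      calc ∫⁻ p : Eucl d × Eucl d, ENNReal.ofReal (κ * (1 + ‖p.1‖ ^ 2 + ‖p.2‖ ^ 2)) ∂γ
          = ENNReal.ofReal κ * (1 + (∫⁻ p, ‖p.1‖ₑ ^ 2 ∂γ) + ∫⁻ p, ‖p.2‖ₑ ^ 2 ∂γ) := by
            have h1 : ∀ p : Eucl d × Eucl d,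
                ENNReal.ofReal (κ * (1 + ‖p.1‖ ^ 2 + ‖p.2‖ ^ 2)) =
                ENNReal.ofReal κ * (1 + ‖p.1‖ₑ ^ 2 + ‖p.2‖ₑ ^ 2) := fun p => by
              rw [ENNReal.ofReal_mul hκ0, ENNReal.ofReal_add (by positivity) (by positivity),
                ENNReal.ofReal_add (by positivity) (by positivity), ENNReal.ofReal_one,
                enorm_sq_eq_ofReal, enorm_sq_eq_ofReal]
            simp_rw [h1]
            rw [lintegral_const_mul _ (by fun_prop), lintegral_add_left (by fun_prop),
              lintegral_add_left (by fun_prop)]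
            simp
        _ ≤ ENNReal.ofReal κ * (1 + ENNReal.ofReal M + ENNReal.ofReal M) := by gcongr
        _ = ENNReal.ofReal (c * h * B) := by
            rw [← ENNReal.ofReal_one, ← ENNReal.ofReal_add (by norm_num) hM0,
              ← ENNReal.ofReal_add (by positivity) hM0, ← ENNReal.ofReal_mul hκ0]
            congr 1
            rw [hB, hκ]
            field_simp
            ring
    calc ∫⁻ p, ENNReal.ofReal (oddCost a ε ‖p.1 - p.2‖) ∂coupledLaw bbar b ν h γ
        ≤ ∫⁻ p, ∫⁻ u, ENNReal.ofReal (reflectedCost a ε (2 * √h)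
            ‖(p.1 + h • bbar p.1 u) - (p.2 + h • b p.2)‖) ∂ν ∂γ :=
          lintegral_oddCost_coupledLaw_le ha.le hε.le hh hest.measurable hbm γ
      _ ≤ ∫⁻ p, (ENNReal.ofReal (1 - c * h) * ENNReal.ofReal (oddCost a ε ‖p.1 - p.2‖) +
            ENNReal.ofReal (κ * (1 + ‖p.1‖ ^ 2 + ‖p.2‖ ^ 2))) ∂γ := by
          refine lintegral_mono fun p => ?_
          refine lintegral_reflectedCost_le ha hε hb hσ hα hh hlt3.le hlt4.le (by linarith) hest
            p.1 p.2 hx₀ ?_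
          exact hcontr h hh hlt1 ‖p.1 - p.2‖ _ (norm_nonneg _) (norm_nonneg _)
            (hb.norm_step_sub_le hh _ _) fun hR => hb.sq_norm_step_sub_le hh hlt5.le hR
      _ = ENNReal.ofReal (1 - c * h) * ∫⁻ p, ENNReal.ofReal (oddCost a ε ‖p.1 - p.2‖) ∂γ +
            ∫⁻ p : Eucl d × Eucl d, ENNReal.ofReal (κ * (1 + ‖p.1‖ ^ 2 + ‖p.2‖ ^ 2)) ∂γ := by
          rw [lintegral_add_left (by fun_prop), lintegral_const_mul _ hF]
      _ ≤ ENNReal.ofReal (1 - c * h) * ∫⁻ p, ENNReal.ofReal (oddCost a ε ‖p.1 - p.2‖) ∂γ +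
            ENNReal.ofReal (c * h * B) := by gcongr
      _ ≤ ENNReal.ofReal B := ofReal_affine_le (by positivity) (by linarith) hB0 hcost

end Coupling

/-! ### Comparison of the Wasserstein distances to the invariant measure -/

theorem theorem1p2 {d : ℕ} (b : Eucl d → Eucl d) (L K R : ℝ)
    (hb : ContractiveAtInfinity b L K R)
    (σ α : ℝ) (hσ : 0 < σ) (hα : 0 < α)
    (μ₀ : Measure (Eucl d)) [IsProbabilityMeasure μ₀] (hμ₀ : MemLp id 2 μ₀)
    (π : Measure (Eucl d)) (hπ : IsInvariantMeasure b π) :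
    ∃ h₀ C₁ C₂ : ℝ, 0 < h₀ ∧ 0 < C₁ ∧ 0 < C₂ ∧
      ∀ h : ℝ, 0 < h → h < h₀ →
      ∀ (n : ℕ) (bbar : Eucl d → Eucl n → Eucl d) (ν : Measure (Eucl n)),
        IsProbabilityMeasure ν → IsDriftEstimator b bbar ν σ α h →
      ∀ (Ω Ω' : Type*) (_ : MeasurableSpace Ω) (_ : MeasurableSpace Ω')
        (P : Measure Ω) (P' : Measure Ω') (ξ X : ℕ → Ω → Eucl d)
        (ξ' Xbar : ℕ → Ω' → Eucl d) (U : ℕ → Ω' → Eucl n),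
        IsProbabilityMeasure P → IsProbabilityMeasure P' →
        IsEulerScheme b h μ₀ P ξ X →
        IsRandomisedEulerScheme bbar ν h μ₀ P' ξ' U Xbar →
      ∀ k : ℕ,
        wasserstein 2 (P'.map (Xbar k)) π ≤
            wasserstein 2 (P.map (X k)) π + ENNReal.ofReal (C₂ * h ^ (α / 4)) ∧
        wasserstein 1 (P'.map (Xbar k)) π ≤
            wasserstein 1 (P.map (X k)) π + ENNReal.ofReal (C₁ * h ^ (α / 2)) := by
  obtain ⟨a, ε, C, h₀, ha, hε, hC, hh₀, H⟩ := exists_coupling_eulerLaw hb hσ hα μ₀ hμ₀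
  obtain ⟨κ, hκ, hκF⟩ := exists_mul_le_oddCost ha hε
  refine ⟨h₀, C / κ, √(C / ε), hh₀, by positivity, by positivity, ?_⟩
  intro h hh hlt n bbar ν hν hest Ω Ω' _ _ P P' ξ X ξ' Xbar U hP hP' hX hXbar k
  obtain ⟨γ, hγ, hcost⟩ := H h hh hlt n bbar ν hν hest k
  have hself := isDriftEstimator_self hb.measurable ν σ α h
  have hprob := isProbabilityMeasure_eulerLaw (ν := ν) (h := h) (μ₀ := μ₀) hself.measurable k
  rw [hXbar.map_eq hest.measurable k, hX.map_eq hb.measurable ν k]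
  have hF : Measurable fun p : Eucl d × Eucl d => ENNReal.ofReal (oddCost a ε ‖p.1 - p.2‖) :=
    (measurable_oddCost.comp (by fun_prop)).ennreal_ofReal
  constructor
  · refine (wasserstein_le_add one_le_two hγ).trans ?_
    gcongr
    have h1 : ∫⁻ p, edist p.1 p.2 ^ (2 : ℝ) ∂γ ≤ ENNReal.ofReal (C / ε * h ^ (α / 2)) := by
      calc ∫⁻ p, edist p.1 p.2 ^ (2 : ℝ) ∂γ
          ≤ ∫⁻ p, ENNReal.ofReal ε⁻¹ * ENNReal.ofReal (oddCost a ε ‖p.1 - p.2‖) ∂γ := by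
            refine lintegral_mono fun p => ?_
            rw [edist_eq_enorm_sub, ENNReal.rpow_ofNat, enorm_sq_eq_ofReal,
              ← ENNReal.ofReal_mul (by positivity)]
            refine ENNReal.ofReal_le_ofReal ?_
            rw [← div_eq_inv_mul, le_div_iff₀ hε, mul_comm]
            exact mul_sq_le_oddCost ha.le (norm_nonneg _)
        _ ≤ ENNReal.ofReal ε⁻¹ * ENNReal.ofReal (C * h ^ (α / 2)) := by
            rw [lintegral_const_mul _ hF]
            gcongr
        _ = _ := by
            rw [← ENNReal.ofReal_mul (by positivity)]
            congr 1
            ring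
    calc (∫⁻ p, edist p.1 p.2 ^ (2 : ℝ) ∂γ) ^ (1 / (2 : ℝ))
        ≤ ENNReal.ofReal (C / ε * h ^ (α / 2)) ^ (1 / (2 : ℝ)) := by gcongr
      _ = ENNReal.ofReal (√(C / ε) * h ^ (α / 4)) := by
          rw [ENNReal.ofReal_rpow_of_nonneg (by positivity) (by norm_num),
            Real.mul_rpow (by positivity) (by positivity), ← Real.sqrt_eq_rpow,
            ← Real.rpow_mul hh.le]
          ring_nf
  · refine (wasserstein_le_add le_rfl hγ).trans ?_
    gcongr
    rw [one_div_one, ENNReal.rpow_one]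
    simp_rw [ENNReal.rpow_one]
    calc ∫⁻ p, edist p.1 p.2 ∂γ
        ≤ ∫⁻ p, ENNReal.ofReal κ⁻¹ * ENNReal.ofReal (oddCost a ε ‖p.1 - p.2‖) ∂γ := by
          refine lintegral_mono fun p => ?_
          rw [edist_dist, dist_eq_norm, ← ENNReal.ofReal_mul (by positivity)]
          refine ENNReal.ofReal_le_ofReal ?_
          rw [← div_eq_inv_mul, le_div_iff₀ hκ, mul_comm]
          exact hκF _ (norm_nonneg _)
      _ ≤ ENNReal.ofReal κ⁻¹ * ENNReal.ofReal (C * h ^ (α / 2)) := by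
          rw [lintegral_const_mul _ hF]
          gcongr
      _ = _ := by
          rw [← ENNReal.ofReal_mul (by positivity)]
          congr 1
          ring
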